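/- **Setting.** Let $n\ge 1$, $\omega=e^{2\pi i/n}$, and let $\Gamma=\langle\gamma\rangle$ be cyclic of order $n$. Let $\mathcal D=\mathbb C[\partial,y^{\pm1}]*\Gamma$ be the crossed product of the localized first Weyl algebra ($\partial y-y\partial=1$) with $\Gamma$, where $y\gamma=\omega\gamma y$ and $\gamma\partial=\omega\partial\gamma$. Put $e_i=\frac1n\sum_{j=0}^{n-1}(\omega^i\gamma)^j$ and $e=e_0$. For $\mathbf k=(k_1,\dots,k_{n-1})\in\mathbb C^{n-1}$ put $d_{\mathbf k}=\partial-y^{-1}\sum_{i=1}^{n-1}k_ie_i$, let $H_{\mathbf k}\subseteq\mathcal D$ be the subalgebra generated by $d_{\mathbf k},y,\Gamma$, and $U_{\mathbf k}=eH_{\mathbf k}e$. Let $\mathbf v_1,\dots,\mathbf v_{n-1}$ be the standard basis, $\mathbf w_p=n(\mathbf v_1+\dots+\mathbf v_p)$, and $F(\mathbf b)=\sum_p b_p\mathbf w_p$ for $\mathbf b\in\mathbb N^{n-1}$; write $\mathbf r'\ge\mathbf r$ if $\mathbf r'-\mathbf r\in F(\mathbb N^{n-1})$. Put $B(\mathbf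 k+\mathbf w_p,\mathbf k)=eH_{\mathbf k+\mathbf w_p}e_py^p$ and $B(\mathbf r,\mathbf r)=U_{\mathbf r}$. For $\mathbf r'\ge\mathbf r$ choose a chain $\mathbf r=\mathbf r_0,\dots,\mathbf r_s=\mathbf r'$ whose successive differences are vectors $\mathbf w_p$, and put $B(\mathbf r',\mathbf r)=B(\mathbf r_s,\mathbf r_{s-1})\cdots B(\mathbf r_1,\mathbf r_0)\subseteq e\mathcal De$. Put $a_i=(n-i+k_i)/n$ for $1\le i\le n-1$ and $a_n=0$. The vector $\mathbf k$ is *dominant* if $a_i-a_j>0$ whenever $1\le i<j\le n$ and $a_i-a_j\in\mathbb Z$. Let $\mathcal D_N=\bigoplus_{i\le N}(\mathbb C[y^{\pm1}]*\Gamma)\,\partial^i$ ($\mathcal D_{-1}=0$), and for $B\subseteq\mathcal D$ let $\operatorname{gr}B=\bigoplus_{N\ge0}(B\cap\mathcal D_N)/(B\cap\mathcal D_{N-1})$. If $\beta\in B\cap\mathcal D_N$ and $\beta\equiv e f(y)\partial^N \pmod{\mathcal D_{N-1}}$ with $f\in\mathbb C[y^{\pm1}]$, we say that the class of $\beta$ in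 $\operatorname{gr}B$ has symbol $f(u)v^N\in\mathbb C[u^{\pm1},v^{\pm1}]$. Let $X$ be the toric surface of the fan in $\mathbb Z^2$ with rays through $v_j=(1,j)$, $0\le j\le n$, and two-dimensional cones $\mathbb R^+v_{i-1}+\mathbb R^+v_i$, $1\le i\le n$; it is the minimal resolution of $\mathbb C^2/\Gamma$. Let $x,z$ be the coordinates of its torus (the characters $(1,0),(0,1)$), embedded in $\mathbb C(u,v)$ by $x=uv$, $z=v^n$. Let $D_j$ be the torus invariant prime divisor of $v_j$, and put $D(i)=\sum_{j=0}^{i-1}(i-j)D_{n-j}$ and $D(\mathbf b)=\sum_{i=1}^{n-1}b_iD(i)$. **Theorem.** Assume that $\mathbf k\in\mathbb C^{n-1}$ is dominant, and that $\mathbf r'\ge\mathbf r\ge\mathbf k$ with $\mathbf r'=\mathbf r+F(\mathbf b)$, $\mathbf b\in\mathbb N^{n-1}$. Then, whichever chain is used to form $B(\mathbf r',\mathbf r)$, every class in every graded piece of $\operatorname{gr}B(\mathbf r',\mathbf r)$ has a symbol, this symbol lies in $\mathbb C[x^{\pm1},z^{\pm1}]$, and $\operatorname{gr}B(\mathbf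 r',\mathbf r)=H^0(X,\mathcal O(D(\mathbf b)))$ up to multiplication by $x^{\sum_i ib_i}$: there is a $\mathbb C$-linear bijection $$\Psi:\operatorname{gr}B(\mathbf r',\mathbf r)\longrightarrow H^0(X,\mathcal O(D(\mathbf b)))\subset\mathbb C(X)$$ such that for every element of a graded piece of $\operatorname{gr}B(\mathbf r',\mathbf r)$ its symbol equals $x^{\sum_{i=1}^{n-1} i b_i}$ times its image under $\Psi$. -/

import Mathlib

namespace Kleinian

section Geometry

open CategoryTheory CategoryTheory.Limits AlgebraicGeometry

/-! ### The toric surface and the sheaves `O(D(b))` -/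

/-- The pairing `⟨m, v_j⟩` of `m ∈ M = ℤ²` with the lattice vector `v_j = (1, j)`. -/
def pair (m : ℤ × ℤ) (j : ℕ) : ℤ := m.1 + j * m.2

lemma pair_add (m m' : ℤ × ℤ) (j : ℕ) : pair (m + m') j = pair m j + pair m' j := by
  simp only [pair, Prod.fst_add, Prod.snd_add]; ring

/-- The cones of the fan `Δ` spanned by `v_0, …, v_n`: the zero cone, the rays `ℝ⁺ v_j` and the
two-dimensional cones `ℝ⁺ v_{i} + ℝ⁺ v_{i+1}`, each given by the set of (the indices of) its
ray generators and ordered by the face relation. -/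
abbrev FanCone (n : ℕ) : Type :=
  {S : Finset (Fin (n + 1)) // ∃ i : Fin n, S ⊆ {i.castSucc, i.succ}}

/-- The semigroup `σ^∨ ∩ M` of the cone `σ` spanned by the `v_j`, `j ∈ S`. -/
def dualMonoid {n : ℕ} (S : Finset (Fin (n + 1))) : AddSubmonoid (ℤ × ℤ) where
  carrier := {m | ∀ j ∈ S, 0 ≤ pair m j}
  zero_mem' := fun j _ => by simp [pair]
  add_mem' := fun {a b} ha hb j hj => by
    rw [pair_add]; exact add_nonneg (ha j hj) (hb j hj)

lemma dualMonoid_anti {n : ℕ} {S T : Finset (Fin (n + 1))} (h : S ⊆ T) :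
    dualMonoid T ≤ dualMonoid S := fun _ hm j hj => hm j (h hj)

/-- The coordinate ring `ℂ[σ^∨ ∩ M]` of the affine toric chart of the cone spanned by `S`. -/
abbrev ChartRing {n : ℕ} (S : Finset (Fin (n + 1))) : Type :=
  AddMonoidAlgebra ℂ (dualMonoid S)

/-- The inclusion `ℂ[τ^∨ ∩ M] → ℂ[σ^∨ ∩ M]` for a face `σ` of `τ`. -/
noncomputable def chartMap {n : ℕ} {S T : Finset (Fin (n + 1))} (h : S ⊆ T) :
    ChartRing T →+* ChartRing S :=
  AddMonoidAlgebra.mapDomainRingHom ℂ (AddSubmonoid.inclusion (dualMonoid_anti h))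

lemma chartMap_single {n : ℕ} {S T : Finset (Fin (n + 1))} (h : S ⊆ T)
    (m : dualMonoid T) (c : ℂ) : chartMap h (AddMonoidAlgebra.single m c) =
      AddMonoidAlgebra.single (AddSubmonoid.inclusion (dualMonoid_anti h) m) c := by
  simp [chartMap]

lemma chartMap_injective {n : ℕ} {S T : Finset (Fin (n + 1))} (h : S ⊆ T) :
    Function.Injective (chartMap h) :=
  AddMonoidAlgebra.mapDomain_injective (AddSubmonoid.inclusion_injective _)

lemma chartMap_refl {n : ℕ} (S : Finset (Fin (n + 1))) (h : S ⊆ S) :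
    chartMap h = RingHom.id (ChartRing S) := by
  have : AddSubmonoid.inclusion (dualMonoid_anti h) = AddMonoidHom.id (dualMonoid S) := by
    ext <;> rfl
  rw [chartMap, this, AddMonoidAlgebra.mapDomainRingHom_id]

lemma chartMap_comp {n : ℕ} {S T R : Finset (Fin (n + 1))} (h : S ⊆ T) (h' : T ⊆ R) :
    (chartMap h).comp (chartMap h') = chartMap (h.trans h') := by
  rw [chartMap, chartMap, chartMap, ← AddMonoidAlgebra.mapDomainRingHom_comp]
  rfl

/-- A lattice point of `τ^∨` which vanishes on the face `σ` of `τ` and is positive on the other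
generators of `τ`. -/
lemma exists_facePoint {n : ℕ} {S T : Finset (Fin (n + 1))}
    (hT : ∃ i : Fin n, T ⊆ {i.castSucc, i.succ}) (h : S ⊆ T) :
    ∃ m : ℤ × ℤ, (∀ j ∈ S, pair m j = 0) ∧ ∀ j ∈ T, j ∉ S → pair m j = 1 := by
  obtain ⟨i, hi⟩ := hT
  refine ⟨(if i.castSucc ∈ S then 0 else ((i : ℤ) + 1, -1)) +
    (if i.succ ∈ S then 0 else (-(i : ℤ), 1)), ?_, ?_⟩
  · intro j hj
    have := hi (h hj)
    simp only [Finset.mem_insert, Finset.mem_singleton] at this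
    rcases this with rfl | rfl <;> split_ifs <;> simp [pair]
  · intro j hj hjS
    have := hi hj
    simp only [Finset.mem_insert, Finset.mem_singleton] at this
    rcases this with rfl | rfl <;> split_ifs <;> simp [pair]

lemma chart_isLocalization {n : ℕ} {S T : Finset (Fin (n + 1))} (h : S ⊆ T)
    (m : dualMonoid T) (hmS : ∀ j ∈ S, pair m j = 0)
    (hmT : ∀ j ∈ T, j ∉ S → 1 ≤ pair m j) :
    letI := (chartMap h).toAlgebra
    IsLocalization.Away (AddMonoidAlgebra.single m (1 : ℂ)) (ChartRing S) := by
  let := (chartMap h).toAlgebra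
  have key : ∀ z : ChartRing S, ∃ (N : ℕ) (a : ChartRing T),
      z * chartMap h (AddMonoidAlgebra.single m (1 : ℂ)) ^ N = chartMap h a := by
    intro z
    induction z using AddMonoidAlgebra.induction_linear with
    | zero => exact ⟨0, 0, by simp⟩
    | add f g hf hg =>
      obtain ⟨N, a, ha⟩ := hf
      obtain ⟨N', b, hb⟩ := hg
      refine ⟨N + N', a * AddMonoidAlgebra.single m (1 : ℂ) ^ N' +
        b * AddMonoidAlgebra.single m (1 : ℂ) ^ N, ?_⟩
      rw [map_add, map_mul, map_mul, ← ha, ← hb, map_pow, map_pow]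
      ring
    | single w c =>
      obtain ⟨w, hw⟩ := w
      obtain ⟨N, hN⟩ : ∃ N : ℕ, ∀ j ∈ T, -pair w j ≤ N := by
        refine ⟨∑ j ∈ T, (-pair w j).toNat, fun j hj => ?_⟩
        have h1 : (-pair w j).toNat ≤ ∑ j ∈ T, (-pair w j).toNat :=
          Finset.single_le_sum (f := fun j : Fin (n + 1) => (-pair w j).toNat)
            (fun _ _ => Nat.zero_le _) hj
        have h2 := Int.self_le_toNat (-pair w j)
        omega
      have hpairN : ∀ (N : ℕ) (j : ℕ), pair (w + N • (m : ℤ × ℤ)) j = pair w j + N * pair m j := by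
        intro N j
        simp only [pair, Prod.fst_add, Prod.snd_add, Prod.smul_fst, Prod.smul_snd,
          Int.nsmul_eq_mul]
        ring
      have hmem : w + N • (m : ℤ × ℤ) ∈ dualMonoid T := by
        intro j hj
        rw [hpairN]
        by_cases hjS : j ∈ S
        · rw [hmS j hjS]; simpa using hw j hjS
        · have h2 := hN j hj
          have h3 := hmT j hj hjS
          have h4 : (N : ℤ) * 1 ≤ N * pair m j := by gcongr
          omega
      refine ⟨N, AddMonoidAlgebra.single ⟨_, hmem⟩ c, ?_⟩
      rw [chartMap_single, chartMap_single, AddMonoidAlgebra.single_pow,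
        AddMonoidAlgebra.single_mul_single]
      congr 1
      simp
  rw [IsLocalization.Away, isLocalization_iff]
  refine ⟨?_, ?_, ?_⟩
  · rintro ⟨_, N, rfl⟩
    change IsUnit (chartMap h (_ ^ N))
    rw [map_pow]
    refine IsUnit.pow _ ?_
    rw [chartMap_single]
    have hneg : -(m : ℤ × ℤ) ∈ dualMonoid S := by
      intro j hj
      have := hmS j hj
      simp only [pair, Prod.fst_neg, Prod.snd_neg] at this ⊢
      linarith
    refine IsUnit.of_mul_eq_one (AddMonoidAlgebra.single ⟨_, hneg⟩ (1 : ℂ)) ?_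
    rw [AddMonoidAlgebra.single_mul_single, AddMonoidAlgebra.one_def]
    congr 1
    · ext <;> simp
    · simp
  · intro z
    obtain ⟨N, a, ha⟩ := key z
    refine ⟨(a, ⟨_, N, rfl⟩), ?_⟩
    change z * chartMap h (_ ^ N) = chartMap h a
    rw [map_pow]
    exact ha
  · intro x y hxy
    exact ⟨1, by rw [chartMap_injective h hxy]⟩

/-- The diagram of affine toric charts `σ ↦ Spec ℂ[σ^∨ ∩ M]` of the fan `Δ`. -/
noncomputable def fanDiagram (n : ℕ) : FanCone n ⥤ Scheme.{0} where
  obj σ := Spec (CommRingCat.of (ChartRing σ.1))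
  map f := Spec.map (CommRingCat.ofHom (chartMap (leOfHom f)))
  map_id σ := by
    rw [chartMap_refl]; exact Spec.map_id _
  map_comp f g := by
    rw [← Spec.map_comp, ← CommRingCat.ofHom_comp, chartMap_comp]

lemma facePoint_mem {n : ℕ} {S T : Finset (Fin (n + 1))} {m : ℤ × ℤ}
    (h0 : ∀ j ∈ S, pair m j = 0) (h1 : ∀ j ∈ T, j ∉ S → 1 ≤ pair m j) : m ∈ dualMonoid T := by
  intro j hj
  by_cases hjS : j ∈ S
  · rw [h0 j hjS]
  · have := h1 j hj hjS; omega

instance fanDiagram_isOpenImmersion (n : ℕ) {σ τ : FanCone n} (f : σ ⟶ τ) :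
    IsOpenImmersion ((fanDiagram n).map f) := by
  obtain ⟨m, h0, h1⟩ := exists_facePoint τ.2 (leOfHom f)
  let := (chartMap (leOfHom f)).toAlgebra
  have := chart_isLocalization (leOfHom f) ⟨m, facePoint_mem h0 (fun j hj hj' => (h1 j hj hj').ge)⟩
    h0 (fun j hj hj' => (h1 j hj hj').ge)
  exact IsOpenImmersion.of_isLocalization (S := ChartRing σ.1)
    (AddMonoidAlgebra.single (⟨m, _⟩ : dualMonoid τ.1) (1 : ℂ))

lemma fanDiagram_mem_range {n : ℕ} {σ τ : FanCone n} (f : σ ⟶ τ) (m : dualMonoid τ.1)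
    (h0 : ∀ j ∈ σ.1, pair m j = 0) (h1 : ∀ j ∈ τ.1, j ∉ σ.1 → 1 ≤ pair m j)
    (p : PrimeSpectrum (ChartRing τ.1)) :
    (p ∈ Set.range ((fanDiagram n).map f : _ → _)) ↔
      AddMonoidAlgebra.single m (1 : ℂ) ∉ p.asIdeal := by
  let := (chartMap (leOfHom f)).toAlgebra
  have := chart_isLocalization (leOfHom f) m h0 h1
  have h := PrimeSpectrum.localization_away_comap_range (ChartRing σ.1)
    (AddMonoidAlgebra.single m (1 : ℂ))
  exact Set.ext_iff.mp h p

instance fanDiagram_isLocallyDirected (n : ℕ) :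
    (fanDiagram n ⋙ Scheme.forget).IsLocallyDirected := by
  refine ⟨fun {σ σ' τ} f f' x x' hx => ?_⟩
  change (fanDiagram n).map f x = (fanDiagram n).map f' x' at hx
  let ρ : FanCone n := ⟨σ.1 ∩ σ'.1, by
    obtain ⟨i, hi⟩ := σ.2
    exact ⟨i, Finset.inter_subset_left.trans hi⟩⟩
  let g : ρ ⟶ σ := homOfLE (Finset.inter_subset_left : σ.1 ∩ σ'.1 ⊆ σ.1)
  let g' : ρ ⟶ σ' := homOfLE (Finset.inter_subset_right : σ.1 ∩ σ'.1 ⊆ σ'.1)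
  obtain ⟨m, h0, h1⟩ := exists_facePoint τ.2 (leOfHom f)
  obtain ⟨m', h0', h1'⟩ := exists_facePoint τ.2 (leOfHom f')
  have hm := facePoint_mem h0 (fun j hj hj' => (h1 j hj hj').ge)
  have hm' := facePoint_mem h0' (fun j hj hj' => (h1' j hj hj').ge)
  have hp := (fanDiagram_mem_range f ⟨m, hm⟩ h0 (fun j hj hj' => (h1 j hj hj').ge) _).mp ⟨x, rfl⟩
  have hp' := (fanDiagram_mem_range f' ⟨m', hm'⟩ h0'
    (fun j hj hj' => (h1' j hj hj').ge) _).mp ⟨x', rfl⟩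
  rw [← hx] at hp'
  have hpp : ((fanDiagram n).map f x) ∈ Set.range ((fanDiagram n).map (g ≫ f) : _ → _) := by
    refine (fanDiagram_mem_range (g ≫ f) ⟨m + m', add_mem hm hm'⟩ ?_ ?_ _).mpr ?_
    · intro j hj
      rw [Finset.mem_inter] at hj
      change pair (m + m') j = 0
      rw [pair_add, h0 j hj.1, h0' j hj.2, add_zero]
    · intro j hj hj'
      rw [Finset.mem_inter, not_and_or] at hj'
      change 1 ≤ pair (m + m') j
      rw [pair_add]
      have a1 := hm j hj
      have a2 := hm' j hj
      rcases hj' with hj' | hj'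
      · have := h1 j hj hj'; omega
      · have := h1' j hj hj'; omega
    · have : AddMonoidAlgebra.single (⟨m + m', add_mem hm hm'⟩ : dualMonoid τ.1) (1 : ℂ) =
          AddMonoidAlgebra.single ⟨m, hm⟩ 1 * AddMonoidAlgebra.single ⟨m', hm'⟩ 1 := by
        rw [AddMonoidAlgebra.single_mul_single]
        simp
      rw [this]
      intro hmem
      rcases (PrimeSpectrum.isPrime _).mem_or_mem hmem with h | h
      · exact hp h
      · exact hp' h
  obtain ⟨z, hz⟩ := hpp
  refine ⟨ρ, g, g', z, ?_, ?_⟩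
  · apply ((fanDiagram n).map f).isOpenEmbedding.injective
    change ((fanDiagram n).map f) ((fanDiagram n).map g z) = _
    rw [← hz, Functor.map_comp]
    rfl
  · apply ((fanDiagram n).map f').isOpenEmbedding.injective
    change ((fanDiagram n).map f') ((fanDiagram n).map g' z) = ((fanDiagram n).map f') x'
    rw [← hx, ← hz, ← Scheme.Hom.comp_apply, ← Functor.map_comp,
      Subsingleton.elim (g' ≫ f') (g ≫ f)]

/-- The toric surface `X = X(Δ)`, glued from the charts `Spec ℂ[σ^∨ ∩ M]` along the inclusions
of faces; it is the minimal resolution of `ℂ²/Γ`. -/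
noncomputable def ToricSurface (n : ℕ) : Scheme.{0} := colimit (fanDiagram n)

/-- The open immersion of the affine chart of the cone `σ` into `X`. -/
noncomputable def chart {n : ℕ} (σ : FanCone n) :
    Spec (CommRingCat.of (ChartRing σ.1)) ⟶ ToricSurface n :=
  colimit.ι (fanDiagram n) σ

instance chart_isOpenImmersion {n : ℕ} (σ : FanCone n) : IsOpenImmersion (chart σ) :=
  inferInstanceAs (IsOpenImmersion (colimit.ι (fanDiagram n) σ))

/-- The zero cone. -/
def zeroCone (n : ℕ) [NeZero n] : FanCone n := ⟨∅, 0, Finset.empty_subset _⟩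

instance chartRing_isDomain {n : ℕ} (S : Finset (Fin (n + 1))) : IsDomain (ChartRing S) :=
  Function.Injective.isDomain
    (AddMonoidAlgebra.mapDomainRingHom ℂ (dualMonoid S).subtype)
    (AddMonoidAlgebra.mapDomain_injective Subtype.val_injective)

lemma dualMonoid_fg {n : ℕ} (σ : FanCone n) : (dualMonoid σ.1).FG := by
  obtain ⟨S, i, hi⟩ := σ
  let u : ℤ × ℤ := ((i : ℤ) + 1, -1)
  let v : ℤ × ℤ := (-(i : ℤ), 1)
  let G : Set (ℤ × ℤ) := {u, v} ∪ ({w | w = -u ∧ i.castSucc ∉ S} ∪ {w | w = -v ∧ i.succ ∉ S})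
  have hG : G.Finite := by
    refine ((Set.finite_singleton v).insert u).union (Set.Finite.union ?_ ?_)
    · exact (Set.finite_singleton (-u)).subset fun w hw => hw.1
    · exact (Set.finite_singleton (-v)).subset fun w hw => hw.1
  refine (AddSubmonoid.fg_iff _).mpr ⟨G, le_antisymm ?_ ?_, hG⟩
  · rw [AddSubmonoid.closure_le]
    intro w hw j hj
    have hj' := hi hj
    simp only [Finset.mem_insert, Finset.mem_singleton] at hj'
    rcases hw with (rfl | rfl) | ⟨rfl, hS⟩ | ⟨rfl, hS⟩ <;> rcases hj' with rfl | rfl <;>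
      simp_all [pair, u, v]
  · intro m hm
    have hdec : m = pair m i • u + pair m (i + 1) • v := by
      ext <;> simp [pair, u, v] <;> ring
    have hzu : ∀ (t : ℤ) (w : ℤ × ℤ), (w ∈ G) → (0 ≤ t ∨ -w ∈ G) →
        t • w ∈ AddSubmonoid.closure G := by
      intro t w hw ht
      rcases le_total 0 t with h | h
      · obtain ⟨N, rfl⟩ := Int.eq_ofNat_of_zero_le h
        rw [natCast_zsmul]
        exact nsmul_mem (AddSubmonoid.subset_closure hw) N
      · obtain ⟨N, hN⟩ := Int.eq_ofNat_of_zero_le (neg_nonneg.mpr h)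
        rcases ht with ht | ht
        · have : t = 0 := le_antisymm h ht
          rw [this, zero_zsmul]; exact zero_mem _
        · have : t • w = N • (-w) := by
            rw [← natCast_zsmul, ← hN]; simp
          rw [this]
          exact nsmul_mem (AddSubmonoid.subset_closure ht) N
    rw [hdec]
    refine add_mem (hzu _ _ (Or.inl (Or.inl rfl)) ?_) (hzu _ _ (Or.inl (Or.inr rfl)) ?_)
    · by_cases h : i.castSucc ∈ S
      · left; simpa using hm _ h
      · right; exact Or.inr (Or.inl ⟨rfl, h⟩)
    · by_cases h : i.succ ∈ S
      · left; simpa using hm _ h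
      · right; exact Or.inr (Or.inr ⟨rfl, h⟩)

instance chartRing_isNoetherian {n : ℕ} (σ : FanCone n) : IsNoetherianRing (ChartRing σ.1) := by
  have : AddMonoid.FG (dualMonoid σ.1) :=
    (AddMonoid.fg_iff_addSubmonoid_fg _).mpr (dualMonoid_fg σ)
  exact Algebra.FiniteType.isNoetherianRing ℂ (ChartRing σ.1)

instance fanDiagram_obj_isIntegral {n : ℕ} (σ : FanCone n) : IsIntegral ((fanDiagram n).obj σ) :=
  inferInstanceAs (IsIntegral (Spec (CommRingCat.of (ChartRing σ.1))))

instance fanDiagram_obj_isNoetherian {n : ℕ} (σ : FanCone n) :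
    IsLocallyNoetherian ((fanDiagram n).obj σ) :=
  inferInstanceAs (IsLocallyNoetherian (Spec (CommRingCat.of (ChartRing σ.1))))

instance toricSurface_isLocallyNoetherian (n : ℕ) : IsLocallyNoetherian (ToricSurface n) :=
  (isLocallyNoetherian_iff_openCover
    (Scheme.IsLocallyDirected.openCover (fanDiagram n))).mpr fun σ => fanDiagram_obj_isNoetherian σ

instance toricSurface_isReduced (n : ℕ) : IsReduced (ToricSurface n) :=
  (IsReduced.iff_of_openCover _ (Scheme.IsLocallyDirected.openCover (fanDiagram n))).mpr fun σ =>
    @isReduced_of_isIntegral _ (fanDiagram_obj_isIntegral σ)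

instance toricSurface_irreducible (n : ℕ) [NeZero n] : IrreducibleSpace (ToricSurface n) := by
  have key : ∀ U : Set (ToricSurface n), IsOpen U → U.Nonempty →
      (chart (zeroCone n) ⁻¹' U).Nonempty := by
    rintro U hU ⟨x, hx⟩
    obtain ⟨σ, y, rfl⟩ := Scheme.IsLocallyDirected.ι_jointly_surjective (fanDiagram n) x
    let f : zeroCone n ⟶ σ := homOfLE (Finset.empty_subset σ.1 : (∅ : Finset (Fin (n + 1))) ⊆ σ.1)
    have hopen : IsOpen (colimit.ι (fanDiagram n) σ ⁻¹' U) :=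
      hU.preimage (colimit.ι (fanDiagram n) σ).continuous
    obtain ⟨z, hz, w, rfl⟩ := nonempty_preirreducible_inter hopen
      ((fanDiagram n).map f).isOpenEmbedding.isOpen_range ⟨y, hx⟩
      ⟨_, Set.mem_range_self (genericPoint ((fanDiagram n).obj (zeroCone n)))⟩
    refine ⟨w, ?_⟩
    have : colimit.ι (fanDiagram n) (zeroCone n) w =
        colimit.ι (fanDiagram n) σ ((fanDiagram n).map f w) := by
      rw [← Scheme.Hom.comp_apply, colimit.w]
    change colimit.ι (fanDiagram n) (zeroCone n) w ∈ U
    rw [this]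
    exact hz
  have hne : Nonempty (ToricSurface n) :=
    ⟨chart (zeroCone n) (genericPoint ((fanDiagram n).obj (zeroCone n)))⟩
  have : PreirreducibleSpace (ToricSurface n) := by
    refine ⟨fun U V hU hV hU' hV' => ?_⟩
    rw [Set.univ_inter] at hU' hV'
    obtain ⟨w, hw, hw'⟩ := nonempty_preirreducible_inter
      (hU.preimage (chart (zeroCone n)).continuous) (hV.preimage (chart (zeroCone n)).continuous)
      (key U hU hU') (key V hV hV')
    exact ⟨chart (zeroCone n) w, trivial, hw, hw'⟩
  exact { toNonempty := hne }

instance toricSurface_isIntegral (n : ℕ) [NeZero n] : IsIntegral (ToricSurface n) :=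
  isIntegral_of_irreducibleSpace_of_isReduced _

/-- The Laurent polynomial ring `ℂ[M] = ℂ[x^{±1}, z^{±1}]` of the torus; the exponent
`m = (m₁, m₂)` stands for the monomial `x^{m₁} z^{m₂}`. -/
abbrev TorusRing : Type := AddMonoidAlgebra ℂ (ℤ × ℤ)

/-- `ℂ[M]` is the coordinate ring of the chart of the zero cone. -/
noncomputable def toZeroChart (n : ℕ) [NeZero n] : TorusRing →+* ChartRing (zeroCone n).1 :=
  AddMonoidAlgebra.mapDomainRingHom ℂ
    ((AddMonoidHom.id (ℤ × ℤ)).codRestrict (dualMonoid (zeroCone n).1)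
      (fun _ _ hj => absurd hj (Finset.notMem_empty _)))

instance zeroChart_nonempty (n : ℕ) [NeZero n] :
    Nonempty ((chart (zeroCone n)) ''ᵁ ⊤ : (ToricSurface n).Opens) :=
  ⟨⟨chart (zeroCone n) (genericPoint ((fanDiagram n).obj (zeroCone n))), _, trivial, rfl⟩⟩

/-- A Laurent polynomial in `x, z`, i.e. a regular function on the open torus of `X`, viewed as a
rational function on `X`. -/
noncomputable def toRational (n : ℕ) [NeZero n] :
    TorusRing →+* (ToricSurface n).functionField :=
  ((Scheme.ΓSpecIso (CommRingCat.of (ChartRing (zeroCone n).1))).inv ≫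
    ((chart (zeroCone n)).appIso ⊤).inv ≫
    (ToricSurface n).germToFunctionField ((chart (zeroCone n)) ''ᵁ ⊤)).hom.comp (toZeroChart n)

/-- The function field of `X` as an extension of the field of constants `ℂ`. -/
noncomputable instance functionFieldAlgebra (n : ℕ) [NeZero n] :
    Algebra ℂ (ToricSurface n).functionField :=
  ((toRational n).comp (algebraMap ℂ TorusRing)).toAlgebra

/-- The ray `ℝ⁺ v_j`. -/
def ray {n : ℕ} [NeZero n] (j : Fin (n + 1)) : FanCone n :=
  ⟨{j}, by
    induction j using Fin.cases with
    | zero => exact ⟨0, by simp⟩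
    | succ i => exact ⟨i, by simp⟩⟩

/-- Restriction of functions from the chart of the ray `ρ = ℝ⁺ v_j` to the closed torus orbit in
it: `χ^m ↦ χ^m` if `⟨m, v_j⟩ = 0` and `χ^m ↦ 0` if `⟨m, v_j⟩ > 0`. -/
noncomputable def orbitMap {n : ℕ} [NeZero n] (j : Fin (n + 1)) :
    ChartRing (ray j).1 →ₐ[ℂ] TorusRing :=
  AddMonoidAlgebra.lift ℂ TorusRing (dualMonoid (ray j).1)
    { toFun := fun m => if pair (m.toAdd : ℤ × ℤ) j = 0
        then AddMonoidAlgebra.single (m.toAdd : ℤ × ℤ) 1 else 0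
      map_one' := by simp [pair, AddMonoidAlgebra.one_def]
      map_mul' := fun a b => by
        have ha : 0 ≤ pair (a.toAdd : ℤ × ℤ) j := a.toAdd.2 j (Finset.mem_singleton_self j)
        have hb : 0 ≤ pair (b.toAdd : ℤ × ℤ) j := b.toAdd.2 j (Finset.mem_singleton_self j)
        rw [toAdd_mul, AddSubmonoid.coe_add, pair_add]
        by_cases h1 : pair (a.toAdd : ℤ × ℤ) j = 0
        · by_cases h2 : pair (b.toAdd : ℤ × ℤ) j = 0
          · simp [h1, h2, AddMonoidAlgebra.single_mul_single]
          · simp [h1, h2]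
        · have h3 : pair (a.toAdd : ℤ × ℤ) j + pair (b.toAdd : ℤ × ℤ) j ≠ 0 := by omega
          simp [h1, h3] }

/-- The generic point of the torus invariant prime divisor `D_j` of `X` which belongs to the ray
`ℝ⁺ v_j`, i.e. of the closure of the corresponding torus orbit. -/
noncomputable def divisorPoint {n : ℕ} [NeZero n] (j : Fin (n + 1)) : ToricSurface n :=
  chart (ray j) (⟨RingHom.ker (orbitMap j), RingHom.ker_isPrime _⟩ :
    PrimeSpectrum (ChartRing (ray j).1))

/-- The prime divisor `D_j`. Divisors are finite integral combinations of points; a point stands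
for its closure. -/
noncomputable def primeDivisor {n : ℕ} [NeZero n] (j : Fin (n + 1)) : ToricSurface n →₀ ℤ :=
  Finsupp.single (divisorPoint j) 1

/-- The divisor `D(i) = ∑_{j=0}^{i-1} (i - j) D_{n-j}`, for `i = p + 1 ∈ {1, …, n - 1}`. -/
noncomputable def basicDivisor {n : ℕ} [NeZero n] (p : Fin (n - 1)) : ToricSurface n →₀ ℤ :=
  ∑ j ∈ Finset.range (p + 1),
    ((p : ℤ) + 1 - j) • primeDivisor (⟨n - j, by omega⟩ : Fin (n + 1))

/-- The divisor `D(b) = ∑_{i=1}^{n-1} b_i D(i)`; the entry of `b` at `p` is `b_{p+1}`. -/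
noncomputable def divisor {n : ℕ} [NeZero n] (b : Fin (n - 1) → ℕ) : ToricSurface n →₀ ℤ :=
  ∑ p, (b p : ℤ) • basicDivisor p

/-- The sections of `O(D)` over an open set `V`: the rational functions `f` such that `f = 0` or
`div f + D ≥ 0` on `V`. -/
def sections {n : ℕ} [NeZero n] (D : ToricSurface n →₀ ℤ) (V : (ToricSurface n).Opens) :
    Set (ToricSurface n).functionField :=
  {f | f = 0 ∨ ∀ x ∈ V, Order.coheight x = 1 → 0 ≤ Scheme.ord f x + D x}

/-- `H⁰(X, O(D))`. -/
def globalSections {n : ℕ} [NeZero n] (D : ToricSurface n →₀ ℤ) :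
    Set (ToricSurface n).functionField :=
  sections D ⊤

end Geometry

/-! ### The noncommutative side -/

/-- Generators of the crossed product `ℂ[∂, y^{±1}] * Γ`: `y`, `y⁻¹`, `∂` and a generator `γ` of
the cyclic group `Γ`. -/
inductive Gen : Type
  | y : Gen
  | yinv : Gen
  | del : Gen
  | gam : Gen

/-- The root of unity `e^{2πi/n}`. -/
noncomputable def rootOfUnity (n : ℕ) : ℂ := Complex.exp (2 * Real.pi * Complex.I / n)

open FreeAlgebra in
/-- The defining relations of `ℂ[∂, y^{±1}] * Γ`: those of the Weyl algebra localized at `y`, of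
the cyclic group of order `n`, and the action of the group,
`y γ = ω γ y` and `γ ∂ = ω ∂ γ` with `ω = e^{2πi/n}`. -/
inductive Rel (n : ℕ) : FreeAlgebra ℂ Gen → FreeAlgebra ℂ Gen → Prop
  | y_yinv : Rel n (ι ℂ Gen.y * ι ℂ Gen.yinv) 1
  | yinv_y : Rel n (ι ℂ Gen.yinv * ι ℂ Gen.y) 1
  | weyl : Rel n (ι ℂ Gen.del * ι ℂ Gen.y) (ι ℂ Gen.y * ι ℂ Gen.del + 1)
  | gam_pow : Rel n (ι ℂ Gen.gam ^ n) 1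
  | y_gam : Rel n (ι ℂ Gen.y * ι ℂ Gen.gam) (rootOfUnity n • (ι ℂ Gen.gam * ι ℂ Gen.y))
  | gam_del : Rel n (ι ℂ Gen.gam * ι ℂ Gen.del) (rootOfUnity n • (ι ℂ Gen.del * ι ℂ Gen.gam))

/-- The crossed product `ℂ[∂, y^{±1}] * Γ`, for `Γ` cyclic of order `n`. -/
def CrossedProduct (n : ℕ) : Type := RingQuot (Rel n)

noncomputable instance crossedProductRing (n : ℕ) : Ring (CrossedProduct n) :=
  inferInstanceAs (Ring (RingQuot (Rel n)))

noncomputable instance crossedProductAlgebra (n : ℕ) : Algebra ℂ (CrossedProduct n) :=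
  inferInstanceAs (Algebra ℂ (RingQuot (Rel n)))

/-- The projection of the free algebra onto the crossed product. -/
noncomputable def toCrossedProduct (n : ℕ) : FreeAlgebra ℂ Gen →ₐ[ℂ] CrossedProduct n :=
  RingQuot.mkAlgHom ℂ (Rel n)

lemma toCrossedProduct_rel {n : ℕ} {s t : FreeAlgebra ℂ Gen} (h : Rel n s t) :
    toCrossedProduct n s = toCrossedProduct n t :=
  RingQuot.mkAlgHom_rel ℂ h

/-- The generators as elements of the crossed product. -/
noncomputable def gen (n : ℕ) (g : Gen) : CrossedProduct n :=
  toCrossedProduct n (FreeAlgebra.ι ℂ g)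

/-- `y` as a unit of the crossed product. -/
noncomputable def yUnit (n : ℕ) : (CrossedProduct n)ˣ where
  val := gen n Gen.y
  inv := gen n Gen.yinv
  val_inv := by
    rw [gen, gen, ← map_mul, toCrossedProduct_rel Rel.y_yinv, map_one]
  inv_val := by
    rw [gen, gen, ← map_mul, toCrossedProduct_rel Rel.yinv_y, map_one]

/-- `y^a` for an integer `a`. -/
noncomputable def yPow (n : ℕ) (a : ℤ) : CrossedProduct n := ((yUnit n ^ a : (CrossedProduct n)ˣ))

/-- `∂`. -/
noncomputable def del (n : ℕ) : CrossedProduct n := gen n Gen.del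

/-- `γ`. -/
noncomputable def gam (n : ℕ) : CrossedProduct n := gen n Gen.gam

/-- The idempotent `e_i = (1/n) ∑_{j=0}^{n-1} (ω^i γ)^j`. -/
noncomputable def idem (n i : ℕ) : CrossedProduct n :=
  (n : ℂ)⁻¹ • ∑ j ∈ Finset.range n, (rootOfUnity n ^ i • gam n) ^ j

/-- `d_k = ∂ - y⁻¹ ∑_{i=1}^{n-1} k_i e_i`; the entry of the vector `k` at `p : Fin (n - 1)` is
`k_{p+1}`. -/
noncomputable def dunkl {n : ℕ} (k : Fin (n - 1) → ℂ) : CrossedProduct n :=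
  del n - yPow n (-1) * ∑ p : Fin (n - 1), k p • idem n (p + 1)

/-- `H_k`, the subalgebra generated by `d_k`, `y` and `Γ`. -/
noncomputable def algH {n : ℕ} (k : Fin (n - 1) → ℂ) : Subalgebra ℂ (CrossedProduct n) :=
  Algebra.adjoin ℂ {dunkl k, yPow n 1, gam n}

/-- The subspace `a M b`. -/
noncomputable def sandwich {n : ℕ} (a : CrossedProduct n) (M : Submodule ℂ (CrossedProduct n))
    (b : CrossedProduct n) : Submodule ℂ (CrossedProduct n) :=
  M.map (LinearMap.mulRight ℂ b ∘ₗ LinearMap.mulLeft ℂ a)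

/-- The spherical subalgebra `U_k = e H_k e`, `e = e_0`. -/
noncomputable def spherical {n : ℕ} (k : Fin (n - 1) → ℂ) : Submodule ℂ (CrossedProduct n) :=
  sandwich (idem n 0) (Subalgebra.toSubmodule (algH k)) (idem n 0)

/-- The vector `w_i = n (v_1 + ⋯ + v_i)`, for `i = p + 1`. -/
def wVec {n : ℕ} (p : Fin (n - 1)) : Fin (n - 1) → ℂ := fun q => if q ≤ p then (n : ℂ) else 0

/-- `F(b) = ∑_i b_i w_i`. -/
def latticeF {n : ℕ} (b : Fin (n - 1) → ℕ) : Fin (n - 1) → ℂ := ∑ p, b p • wVec p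

/-- The basic bimodule `B(k + w_i, k) = e H_{k + w_i} e_i y^i`, for `i = p + 1`. -/
noncomputable def basicBimodule {n : ℕ} (k : Fin (n - 1) → ℂ) (p : Fin (n - 1)) :
    Submodule ℂ (CrossedProduct n) :=
  sandwich (idem n 0) (Subalgebra.toSubmodule (algH (k + wVec p)))
    (idem n (p + 1) * yPow n ((p : ℤ) + 1))

/-- The bimodule `B(r', r) = B(r_s, r_{s-1}) ⋯ B(r_2, r_1) B(r_1, r_0)` for the chain
`r = r_0, r_1, …, r_s = r'` in which the successive differences `r_t - r_{t-1}` are the vectors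
`w_i` listed in the second argument; `B(r, r) = U_r`. -/
noncomputable def bimodule {n : ℕ} :
    (Fin (n - 1) → ℂ) → List (Fin (n - 1)) → Submodule ℂ (CrossedProduct n)
  | r, [] => spherical r
  | r, p :: l => bimodule (r + wVec p) l * basicBimodule r p

/-- The numbers `a_i = (n - i + k_i) / n` for `1 ≤ i ≤ n - 1`, and `a_n = 0`. -/
noncomputable def aVec {n : ℕ} (k : Fin (n - 1) → ℂ) (i : ℕ) : ℂ :=
  if h : 1 ≤ i ∧ i ≤ n - 1 then ((n : ℂ) - i + k ⟨i - 1, by omega⟩) / n else 0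

/-- `k` is dominant: `(k + ρ, α) > 0` for all positive roots `α = v_i - v_j`, `i < j`, such that
`(a, α)` is an integer. Here `k + ρ = n a`, so that `(k + ρ, α) = n (a_i - a_j)`. -/
def IsDominant {n : ℕ} (k : Fin (n - 1) → ℂ) : Prop :=
  ∀ i j : ℕ, 1 ≤ i → i < j → j ≤ n → ∀ z : ℤ, aVec k i - aVec k j = z → 0 < z

/-- `D_{<N}`, spanned by the `y^a γ^j ∂^i` with `i < N`. -/
noncomputable def orderLT (n N : ℕ) : Submodule ℂ (CrossedProduct n) :=
  Submodule.span ℂ {t | ∃ (a : ℤ) (j i : ℕ), i < N ∧ t = yPow n a * gam n ^ j * del n ^ i}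

/-- The filtration by the order of differential operators:
`D_N = ⨁_{i ≤ N} (ℂ[y^{±1}] * Γ) ∂^i`. -/
noncomputable def orderLE (n N : ℕ) : Submodule ℂ (CrossedProduct n) := orderLT n (N + 1)

/-- The graded piece `(B ∩ D_N) / (B ∩ D_{N-1})` (with `D_{-1} = 0`). -/
abbrev GrPiece {n : ℕ} (B : Submodule ℂ (CrossedProduct n)) (N : ℕ) : Type :=
  ↥(B ⊓ orderLE n N) ⧸ (orderLT n N).submoduleOf (B ⊓ orderLE n N)

/-- The associated graded space of `B` for the order filtration. -/
abbrev Gr {n : ℕ} (B : Submodule ℂ (CrossedProduct n)) : Type := DirectSum ℕ (GrPiece B)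

/-- The class in `gr B` of an element of `B` of order at most `N`. -/
noncomputable def grClass {n : ℕ} (B : Submodule ℂ (CrossedProduct n)) (N : ℕ)
    (β : ↥(B ⊓ orderLE n N)) : Gr B :=
  DirectSum.lof ℂ ℕ (GrPiece B) N (Submodule.Quotient.mk β)

/-- The operator `f(y)` for a Laurent polynomial `f`, given by its coefficients. -/
noncomputable def evalY (n : ℕ) (f : ℤ →₀ ℂ) : CrossedProduct n := f.sum fun a c => c • yPow n a

/-- The Laurent polynomial ring `ℂ[u^{±1}, v^{±1}]`; the exponent `(a, c)` stands for
`u^a v^c`. -/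
abbrev SymbolRing : Type := AddMonoidAlgebra ℂ (ℤ × ℤ)

/-- The symbol `f(u) v^N`. -/
noncomputable def symbol (f : ℤ →₀ ℂ) (N : ℕ) : SymbolRing :=
  f.sum fun a c => AddMonoidAlgebra.single (a, (N : ℤ)) c

/-- The embedding `ℂ[x^{±1}, z^{±1}] → ℂ[u^{±1}, v^{±1}]`, `x ↦ u v`, `z ↦ v^n`. -/
noncomputable def toSymbol (n : ℕ) : TorusRing →+* SymbolRing :=
  AddMonoidAlgebra.mapDomainRingHom ℂ
    { toFun := fun m : ℤ × ℤ => (m.1, m.1 + n * m.2)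
      map_zero' := by simp
      map_add' := fun a b => by ext <;> simp; ring }

/-- The number `∑_{i=1}^{n-1} i b_i`. -/
def weight {n : ℕ} (b : Fin (n - 1) → ℕ) : ℕ := ∑ p : Fin (n - 1), ((p : ℕ) + 1) * b p

end Kleinian

open Kleinian

/-!
Write `E = y ∂` for the Euler operator. The algebra `e 𝒟 e` is spanned by the operators
`y ^ (-n a) φ(E / n) e` with `a ∈ ℤ` and `φ` a polynomial, and each basic bimodule is graded in `a`:
its component of degree `a` consists of the `φ` divisible by a product `G a` of linear factors with
roots at integer translates of the `a_i`. Dominance makes the products that occur in different ways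
of composing two such components coprime, so the product of two of these graded spans is again one,
with the expected factors. Hence `B(r', r)` is the graded span whose factors have multiplicities
depending only on `b`, whatever the chain.

The action on formal series in `y` shows that the `φ` are determined by the operator, and that its
order and leading term can be read off from their degrees and leading coefficients. So
`gr B(r', r)` has the symbols `x ^ m₁ z ^ m₂` with `deg (G m₂) ≤ m₁ + n m₂` as a basis. This
degree is a sum of terms `max 0 _`, one for each `a_i`, and as the multiplicities decrease in `i`
the bound is equivalent to the linear inequalities, one for each ray of the fan, which describe
the characters occurring in `x ^ (∑ i b_i) H⁰(X, 𝒪(D(b)))`. On the geometric side, a rational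
function without poles on the torus is a Laurent polynomial, whose order along `D_j` is the least
value of `⟨m, v_j⟩` over its exponents `m`.
-/

namespace Kleinian

section AffineCharts

open CategoryTheory AlgebraicGeometry

universe u

variable {R S : Type u} [CommRing R] [CommRing S] {X Y Z : Scheme.{u}}

lemma appIso_inv_germ_stalkMap (j : Y ⟶ X) [IsOpenImmersion j] (U : Y.Opens) (p : Y) (hp : p ∈ U)
    (hjp : j p ∈ j ''ᵁ U) :
    (j.appIso U).inv ≫ X.presheaf.germ (j ''ᵁ U) (j p) hjp ≫ j.stalkMap p =
      Y.presheaf.germ U p hp := by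
  rw [Scheme.Hom.germ_stalkMap, Scheme.Hom.appIso_inv_app_assoc]
  exact TopCat.Presheaf.germ_res _ _ _ _

/-- The map from the ring of an affine chart to the stalk at a point of the chart. -/
noncomputable def chartToStalk (j : Spec (.of R) ⟶ X) [IsOpenImmersion j] (p : PrimeSpectrum R) :
    R →+* X.presheaf.stalk (j p) :=
  ((Scheme.ΓSpecIso (.of R)).inv ≫ (j.appIso ⊤).inv ≫
    X.presheaf.germ (j ''ᵁ ⊤) (j p) (Set.mem_image_of_mem _ trivial)).hom

lemma stalkMap_comp_chartToStalk (j : Spec (.of R) ⟶ X) [IsOpenImmersion j]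
    (p : PrimeSpectrum R) :
    (j.stalkMap p).hom.comp (chartToStalk j p) = (StructureSheaf.toStalk R p).hom :=
  congrArg (fun g => CommRingCat.Hom.hom ((Scheme.ΓSpecIso (.of R)).inv ≫ g))
    (appIso_inv_germ_stalkMap j ⊤ p trivial _)

lemma isLocalization_chartToStalk (j : Spec (.of R) ⟶ X) [IsOpenImmersion j]
    (p : PrimeSpectrum R) :
    letI := (chartToStalk j p).toAlgebra
    IsLocalization.AtPrime (X.presheaf.stalk (j p)) p.asIdeal := by
  let := (chartToStalk j p).toAlgebra
  apply (IsLocalization.isLocalization_iff_of_ringEquiv (R := R)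
    (S := X.presheaf.stalk (j p)) p.asIdeal.primeCompl
    (asIso <| j.stalkMap (show Spec (.of R) from p)).commRingCatIsoToRingEquiv).mpr
  convert StructureSheaf.IsLocalization.to_stalk R p
  delta IsLocalization.AtPrime StructureSheaf.stalkAlgebra
  congr!
  rw [← stalkMap_comp_chartToStalk j p]
  rfl

lemma isUnit_chartToStalk (j : Spec (.of R) ⟶ X) [IsOpenImmersion j] {p : PrimeSpectrum R} {r : R}
    (hr : r ∉ p.asIdeal) : IsUnit (chartToStalk j p r) := by
  let := (chartToStalk j p).toAlgebra
  have := isLocalization_chartToStalk j p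
  exact (IsLocalization.AtPrime.isUnit_to_map_iff (X.presheaf.stalk (j p)) p.asIdeal r).mpr hr

lemma maximalIdeal_stalk_eq_span (j : Spec (.of R) ⟶ X) [IsOpenImmersion j]
    {p : PrimeSpectrum R} {r : R} (hp : p.asIdeal = Ideal.span {r}) :
    IsLocalRing.maximalIdeal (X.presheaf.stalk (j p)) = Ideal.span {chartToStalk j p r} := by
  let := (chartToStalk j p).toAlgebra
  have := isLocalization_chartToStalk j p
  have hmax := IsLocalization.AtPrime.map_eq_maximalIdeal p.asIdeal (X.presheaf.stalk (j p))
  rw [hp, Ideal.map_span, Set.image_singleton] at hmax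
  exact hmax.symm

lemma coheight_eq_height (j : Spec (.of R) ⟶ X) [IsOpenImmersion j] (p : PrimeSpectrum R) :
    Order.coheight (j p) = p.asIdeal.height :=
  (coheight_eq_of_isOpenImmersion j).trans (idealHeight_eq_coheight (.of R) p).symm

instance nonempty_image_top (j : Spec (.of R) ⟶ X) [IsOpenImmersion j] [Nonempty (Spec (.of R))] :
    Nonempty (j ''ᵁ ⊤ : X.Opens) :=
  ⟨⟨j (Classical.arbitrary (Spec (.of R))), _, trivial, rfl⟩⟩

lemma bijective_ΓSpecIso_inv_comp_appIso_inv (j : Spec (.of R) ⟶ X) [IsOpenImmersion j] :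
    Function.Bijective ((Scheme.ΓSpecIso (.of R)).inv ≫ (j.appIso ⊤).inv) :=
  ConcreteCategory.bijective_of_isIso _

variable [IsIntegral X]

/-- The map from the ring of an affine chart to the function field. -/
noncomputable def chartToFunctionField (j : Spec (.of R) ⟶ X) [IsOpenImmersion j]
    [Nonempty (Spec (.of R))] : R →+* X.functionField :=
  ((Scheme.ΓSpecIso (.of R)).inv ≫ (j.appIso ⊤).inv ≫ X.germToFunctionField (j ''ᵁ ⊤)).hom

lemma algebraMap_chartToStalk (j : Spec (.of R) ⟶ X) [IsOpenImmersion j]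
    [Nonempty (Spec (.of R))] (p : PrimeSpectrum R) (r : R) :
    algebraMap (X.presheaf.stalk (j p)) X.functionField (chartToStalk j p r) =
      chartToFunctionField j r :=
  Scheme.algebraMap_germ_eq_germToFunctionField _ (U := j ''ᵁ ⊤) (x := j p)
    (show j p ∈ j ''ᵁ ⊤ from Set.mem_image_of_mem _ trivial) _

lemma chartToFunctionField_injective (j : Spec (.of R) ⟶ X) [IsOpenImmersion j]
    [Nonempty (Spec (.of R))] : Function.Injective (chartToFunctionField j) :=
  (X.germToFunctionField_injective (j ''ᵁ ⊤)).comp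
    (bijective_ΓSpecIso_inv_comp_appIso_inv j).injective

lemma chartToStalk_ne_zero (j : Spec (.of R) ⟶ X) [IsOpenImmersion j] [Nonempty (Spec (.of R))]
    (p : PrimeSpectrum R) {r : R} (hr : r ≠ 0) : chartToStalk j p r ≠ 0 := fun h =>
  (map_ne_zero_iff _ (chartToFunctionField_injective j)).mpr hr <| by
    rw [← algebraMap_chartToStalk j p, h, map_zero]

lemma isFractionRing_chartToFunctionField (j : Spec (.of R) ⟶ X) [IsOpenImmersion j]
    [Nonempty (Spec (.of R))] :
    letI := (chartToFunctionField j).toAlgebra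
    IsFractionRing R X.functionField := by
  let := (chartToFunctionField j).toAlgebra
  have : FaithfulSMul R X.functionField :=
    (faithfulSMul_iff_algebraMap_injective _ _).mpr (chartToFunctionField_injective j)
  have := functionField_isFractionRing_of_isAffineOpen X (j ''ᵁ ⊤)
    ((isAffineOpen_top (Spec (.of R))).image_of_isOpenImmersion j)
  have hsurj := (bijective_ΓSpecIso_inv_comp_appIso_inv j).surjective
  refine IsFractionRing.of_field _ _ fun z => ?_
  obtain ⟨x, y, -, rfl⟩ := IsFractionRing.div_surjective (A := Γ(X, j ''ᵁ ⊤)) z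
  obtain ⟨a, rfl⟩ := hsurj x
  obtain ⟨b, rfl⟩ := hsurj y
  exact ⟨a, b, rfl⟩

lemma appLE_appIso_inv_germToFunctionField (g : Z ⟶ Y) (j : Y ⟶ X)
    [IsOpenImmersion j] [IsOpenImmersion (g ≫ j)] (U : Y.Opens) (V : Z.Opens) (e : V ≤ g ⁻¹ᵁ U)
    [Nonempty (j ''ᵁ U : X.Opens)] [Nonempty ((g ≫ j) ''ᵁ V : X.Opens)] :
    g.appLE U V e ≫ ((g ≫ j).appIso V).inv ≫ X.germToFunctionField ((g ≫ j) ''ᵁ V) =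
      (j.appIso U).inv ≫ X.germToFunctionField (j ''ᵁ U) := by
  rw [← Iso.cancel_iso_hom_left (j.appIso U), Iso.hom_inv_id_assoc, Scheme.Hom.appIso_hom',
    Scheme.Hom.appLE_comp_appLE_assoc, Scheme.Hom.appLE_appIso_inv_assoc]
  exact TopCat.Presheaf.germ_res _ _ _ _

lemma chartToFunctionField_comp (f : R →+* S) (j : Spec (.of R) ⟶ X) [IsOpenImmersion j]
    [Nonempty (Spec (.of R))] [Nonempty (Spec (.of S))]
    (j' : Spec (.of S) ⟶ X) [IsOpenImmersion j']
    (h : Spec.map (CommRingCat.ofHom f) ≫ j = j') :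
    (chartToFunctionField j').comp f = chartToFunctionField j := by
  subst h
  have hres := appLE_appIso_inv_germToFunctionField (Spec.map (CommRingCat.ofHom f)) j ⊤ ⊤ le_top
  rw [show (Spec.map (CommRingCat.ofHom f)).appLE ⊤ ⊤ le_top =
    (Spec.map (CommRingCat.ofHom f)).appTop from Scheme.Hom.appLE_eq_app _] at hres
  replace hres := congrArg (fun g => (Scheme.ΓSpecIso (.of R)).inv ≫ g) hres
  simp only [← Scheme.ΓSpecIso_inv_naturality_assoc] at hres
  exact congrArg CommRingCat.Hom.hom hres

lemma ringOrd_eq_one_of_isMaximal {A : Type*} [CommRing A] {a : A}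
    (h : (Ideal.span {a}).IsMaximal) : Ring.ord A a = 1 := by
  rw [Ring.ord, Module.length_eq_one_iff,
    isSimpleModule_iff_isSimpleModule_of_algebraMap_surjective (S := A ⧸ Ideal.span {a})
      Ideal.Quotient.mk_surjective]
  let := Ideal.Quotient.field (Ideal.span {a})
  infer_instance

variable [IsLocallyNoetherian X] (j : Spec (.of R) ⟶ X) [IsOpenImmersion j]
  [Nonempty (Spec (.of R))]

lemma ord_chartToFunctionField_nonneg (p : PrimeSpectrum R) (r : R) :
    0 ≤ Scheme.ord (chartToFunctionField j r) (j p) := by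
  by_cases hp : Order.coheight (j p) = 1
  · rcases eq_or_ne r 0 with rfl | hr
    · rw [map_zero, Scheme.ord_zero]
      rfl
    have : Ring.KrullDimLE 1 (X.presheaf.stalk (j p)) := krullDimLE_of_coheight_le hp.le
    rw [Scheme.le_ord_iff hp ((map_ne_zero_iff _ (chartToFunctionField_injective j)).mpr hr),
      ← algebraMap_chartToStalk j p]
    exact Ring.ordFrac_ge_one_of_ne_zero (chartToStalk_ne_zero j p hr)
  · exact (Scheme.ord_eq_zero_of_coheight_neq_one hp _).ge

lemma ord_chartToFunctionField_of_notMem {p : PrimeSpectrum R} {r : R} (hr : r ∉ p.asIdeal) :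
    Scheme.ord (chartToFunctionField j r) (j p) = 0 := by
  by_cases hp : Order.coheight (j p) = 1
  · have h0 : chartToFunctionField j r ≠ 0 :=
      (map_ne_zero_iff _ (chartToFunctionField_injective j)).mpr fun h => hr (h ▸ zero_mem _)
    have : Ring.KrullDimLE 1 (X.presheaf.stalk (j p)) := krullDimLE_of_coheight_le hp.le
    rw [Scheme.ord_eq_iff hp h0, ← algebraMap_chartToStalk j p]
    exact Ring.ordFrac_of_isUnit (isUnit_chartToStalk j hr)
  · exact Scheme.ord_eq_zero_of_coheight_neq_one hp _

lemma ord_chartToFunctionField_of_eq_span {p : PrimeSpectrum R} (hp : Order.coheight (j p) = 1)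
    {r : R} (hr : r ≠ 0) (hpr : p.asIdeal = Ideal.span {r}) :
    Scheme.ord (chartToFunctionField j r) (j p) = 1 := by
  have : Ring.KrullDimLE 1 (X.presheaf.stalk (j p)) := krullDimLE_of_coheight_le hp.le
  have hr' := chartToStalk_ne_zero j p hr
  rw [Scheme.ord_eq_iff hp ((map_ne_zero_iff _ (chartToFunctionField_injective j)).mpr hr),
    ← algebraMap_chartToStalk j p]
  refine (Ring.ordFrac_eq_ord _ hr').trans ?_
  refine Ring.ordMonoidWithZeroHom_eq_coe _ (mem_nonZeroDivisors_of_ne_zero hr') (n := 1) ?_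
  refine ringOrd_eq_one_of_isMaximal ?_
  rw [← maximalIdeal_stalk_eq_span j hpr]
  infer_instance

lemma exists_height_one_ord_neg_of_not_isUnit [IsDomain R] [UniqueFactorizationMonoid R] {a b : R}
    (ha : a ≠ 0) (hb : b ≠ 0) (hab : IsRelPrime a b) (hu : ¬IsUnit b) :
    ∃ p : PrimeSpectrum R, Order.coheight (j p) = 1 ∧
      Scheme.ord (chartToFunctionField j a / chartToFunctionField j b) (j p) < 0 := by
  have : IsNoetherianRing R :=
    isLocallyNoetherian_Spec.mp (isLocallyNoetherian_of_isOpenImmersion j)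
  have hinj := chartToFunctionField_injective j
  obtain ⟨π, hπ, c, rfl⟩ := WfDvdMonoid.exists_irreducible_factor hu hb
  let p : PrimeSpectrum R :=
    ⟨Ideal.span {π}, (Ideal.span_singleton_prime hπ.ne_zero).mpr hπ.prime⟩
  have hp : Order.coheight (j p) = 1 := by
    rw [coheight_eq_height]
    exact Ideal.height_span_singleton_eq_one_of_mem_nonZeroDivisors
      (mem_nonZeroDivisors_of_ne_zero hπ.ne_zero) hπ.not_isUnit
  have hap : a ∉ p.asIdeal := fun h =>
    hπ.not_isUnit (hab (Ideal.mem_span_singleton.mp h) (dvd_mul_right _ _))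
  have ha' := (map_ne_zero_iff _ hinj).mpr ha
  have hb' := (map_ne_zero_iff _ hinj).mpr hb
  have ord_denominator := map_mul (chartToFunctionField j) π c ▸
    Scheme.ord_mul (x := j p) ((map_ne_zero_iff _ hinj).mpr hπ.ne_zero)
      ((map_ne_zero_iff _ hinj).mpr (right_ne_zero_of_mul hb))
  have ord_fraction := Scheme.ord_mul (x := j p) (div_ne_zero ha' hb') hb'
  rw [div_mul_cancel₀ _ hb', ord_chartToFunctionField_of_notMem j hap] at ord_fraction
  rw [ord_chartToFunctionField_of_eq_span j hp hπ.ne_zero rfl] at ord_denominator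
  have := ord_chartToFunctionField_nonneg j p c
  exact ⟨p, hp, by omega⟩

lemma mem_range_chartToFunctionField [IsDomain R] [UniqueFactorizationMonoid R]
    {f : X.functionField}
    (hf : ∀ p : PrimeSpectrum R, Order.coheight (j p) = 1 → 0 ≤ Scheme.ord f (j p)) :
    f ∈ Set.range (chartToFunctionField j) := by
  let := (chartToFunctionField j).toAlgebra
  have := isFractionRing_chartToFunctionField j
  obtain ⟨a, b, hab, rfl⟩ := IsFractionRing.exists_reduced_fraction R f
  have hdiv : IsLocalization.mk' X.functionField a b =
      chartToFunctionField j a / chartToFunctionField j b := IsFractionRing.mk'_eq_div b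
  rcases eq_or_ne a 0 with rfl | ha
  · exact ⟨0, by rw [hdiv, map_zero, zero_div]⟩
  by_cases hu : IsUnit (b : R)
  · obtain ⟨c, hc⟩ := hu.exists_right_inv
    refine ⟨a * c, ?_⟩
    rw [hdiv, eq_div_iff (hu.map _).ne_zero, ← map_mul, mul_assoc, mul_comm c, hc, mul_one]
  · obtain ⟨p, hp, hneg⟩ :=
      exists_height_one_ord_neg_of_not_isUnit j ha (nonZeroDivisors.ne_zero b.2) hab hu
    exact absurd (hdiv ▸ hf p hp) hneg.not_ge

end AffineCharts

section ToricCharts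

open CategoryTheory CategoryTheory.Limits AlgebraicGeometry

variable {n : ℕ}

/-- Restriction of functions from an affine toric chart to the torus, i.e. the inclusion
`ℂ[σ^∨ ∩ M] → ℂ[M]`. -/
noncomputable def toTorus (S : Finset (Fin (n + 1))) : ChartRing S →+* TorusRing :=
  AddMonoidAlgebra.mapDomainRingHom ℂ (dualMonoid S).subtype

lemma toTorus_single (S : Finset (Fin (n + 1))) (m : dualMonoid S) (c : ℂ) :
    toTorus S (AddMonoidAlgebra.single m c) = AddMonoidAlgebra.single (m : ℤ × ℤ) c := by
  simp [toTorus]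

lemma toTorus_injective (S : Finset (Fin (n + 1))) : Function.Injective (toTorus S) :=
  AddMonoidAlgebra.mapDomain_injective Subtype.val_injective

lemma toTorus_chartMap {S T : Finset (Fin (n + 1))} (h : S ⊆ T) (r : ChartRing T) :
    toTorus S (chartMap h r) = toTorus T r := by
  rw [toTorus, chartMap, ← RingHom.comp_apply, ← AddMonoidAlgebra.mapDomainRingHom_comp]
  rfl

lemma mem_range_toTorus {S : Finset (Fin (n + 1))} {q : TorusRing} :
    q ∈ Set.range (toTorus S) ↔ ∀ m, q.coeff m ≠ 0 → m ∈ dualMonoid S := by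
  constructor
  · rintro ⟨r, rfl⟩ m hm
    by_contra hc
    exact hm (Finsupp.mapDomain_of_notMem_range r.coeff m (by simpa using hc))
  · intro h
    exact ⟨AddMonoidAlgebra.comapDomain _ Subtype.val_injective q,
      AddMonoidAlgebra.mapDomain_comapDomain
        (fun m hm => ⟨⟨m, h m (Finsupp.mem_support_iff.mp hm)⟩, rfl⟩) Subtype.val_injective⟩

lemma exists_eq_single_mul_toTorus {S : Finset (Fin (n + 1))} {a : ℤ × ℤ} {q : TorusRing}
    (h : ∀ m, q.coeff m ≠ 0 → m - a ∈ dualMonoid S) :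
    ∃ r, q = AddMonoidAlgebra.single a 1 * toTorus S r := by
  obtain ⟨r, hr⟩ := mem_range_toTorus (S := S) (q := AddMonoidAlgebra.single (-a) 1 * q) |>.mpr
    fun m hm => by
      rw [AddMonoidAlgebra.coeff_single_mul_apply, one_mul, neg_neg] at hm
      simpa using h _ hm
  refine ⟨r, ?_⟩
  rw [hr, ← mul_assoc, AddMonoidAlgebra.single_mul_single, add_neg_cancel, one_mul,
    ← AddMonoidAlgebra.one_def, one_mul]

/-- The coordinate `x` as a function on an affine toric chart. It vanishes to order one along every
torus invariant divisor of the chart, and nowhere else. -/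
noncomputable def chartX (S : Finset (Fin (n + 1))) : ChartRing S :=
  AddMonoidAlgebra.single (⟨(1, 0), fun j _ => by simp [pair]⟩ : dualMonoid S) 1

lemma chartX_ne_zero (S : Finset (Fin (n + 1))) : chartX S ≠ 0 := by
  simp [chartX]

lemma chartX_dvd_iff {S : Finset (Fin (n + 1))} {r : ChartRing S} :
    chartX S ∣ r ↔ ∀ j ∈ S, ∀ m, pair m j = 0 → (toTorus S r).coeff m = 0 := by
  constructor
  · rintro ⟨s, rfl⟩ j hj m hm
    rw [map_mul, chartX, toTorus_single, AddMonoidAlgebra.coeff_single_mul_apply, one_mul]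
    by_contra hc
    have := mem_range_toTorus.mp ⟨s, rfl⟩ _ hc j hj
    simp only [pair, Prod.fst_add, Prod.fst_neg, Prod.snd_add, Prod.snd_neg] at this hm
    linarith
  · intro h
    obtain ⟨s, hs⟩ := exists_eq_single_mul_toTorus (S := S) (a := (1, 0)) (q := toTorus S r)
      fun m hm j hj => by
        have hnonneg := mem_range_toTorus.mp ⟨r, rfl⟩ m hm j hj
        have hne : pair m j ≠ 0 := fun h0 => hm (h j hj m h0)
        simp only [pair, Prod.fst_sub, Prod.snd_sub, sub_zero] at hnonneg hne ⊢
        omega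
    exact ⟨s, toTorus_injective S (by rw [hs, map_mul, chartX, toTorus_single])⟩

lemma chart_map {σ τ : FanCone n} (f : σ ⟶ τ) (z : (fanDiagram n).obj σ) :
    chart τ ((fanDiagram n).map f z) = chart σ z := by
  change colimit.ι (fanDiagram n) τ ((fanDiagram n).map f z) = colimit.ι (fanDiagram n) σ z
  rw [← Scheme.Hom.comp_apply, colimit.w]

variable [NeZero n]

/-- The inclusion of the zero cone in a cone. -/
def zeroConeHom (σ : FanCone n) : zeroCone n ⟶ σ :=
  homOfLE (Finset.empty_subset σ.1 : (∅ : Finset (Fin (n + 1))) ⊆ σ.1)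

lemma mem_range_map_zeroConeHom {σ : FanCone n} {p : PrimeSpectrum (ChartRing σ.1)} :
    p ∈ Set.range ((fanDiagram n).map (zeroConeHom σ) : _ → _) ↔ chartX σ.1 ∉ p.asIdeal :=
  fanDiagram_mem_range (zeroConeHom σ) ⟨(1, 0), fun j _ => by simp [pair]⟩
    (fun _ hj => absurd hj (Finset.notMem_empty _)) (by simp [pair]) p

section Torus

lemma toTorus_toZeroChart (q : TorusRing) : toTorus _ (toZeroChart n q) = q := by
  rw [toTorus, toZeroChart, ← RingHom.comp_apply, ← AddMonoidAlgebra.mapDomainRingHom_comp]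
  exact RingHom.congr_fun (AddMonoidAlgebra.mapDomainRingHom_id ..) q

/-- The chart of the zero cone is the torus. -/
noncomputable def zeroChartEquiv : ChartRing (zeroCone n).1 ≃+* TorusRing :=
  RingEquiv.ofBijective (toTorus _)
    ⟨toTorus_injective _, fun q => ⟨toZeroChart n q, toTorus_toZeroChart q⟩⟩

lemma toZeroChart_toTorus (r : ChartRing (zeroCone n).1) : toZeroChart n (toTorus _ r) = r :=
  toTorus_injective _ (toTorus_toZeroChart _)

lemma chartToFunctionField_toZeroChart (q : TorusRing) :
    chartToFunctionField (chart (zeroCone n)) (toZeroChart n q) = toRational n q := rfl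

lemma toRational_injective : Function.Injective (toRational n) :=
  (chartToFunctionField_injective (chart (zeroCone n))).comp
    (Function.LeftInverse.injective toTorus_toZeroChart)

lemma chartToFunctionField_chart (σ : FanCone n) (r : ChartRing σ.1) :
    chartToFunctionField (chart σ) r = toRational n (toTorus _ r) := by
  rw [← chartToFunctionField_toZeroChart, ← toTorus_chartMap (leOfHom (zeroConeHom σ)),
    toZeroChart_toTorus, ← chartToFunctionField_comp (chartMap (leOfHom (zeroConeHom σ))) (chart σ)
      (chart (zeroCone n)) (colimit.w (fanDiagram n) (zeroConeHom σ)), RingHom.comp_apply]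

instance torusRing_uniqueFactorizationMonoid : UniqueFactorizationMonoid TorusRing := by
  have : UniqueFactorizationMonoid (LaurentPolynomial ℂ) :=
    .of_isLocalization (Submonoid.powers (Polynomial.X : Polynomial ℂ)) _
  have : UniqueFactorizationMonoid (LaurentPolynomial (LaurentPolynomial ℂ)) :=
    .of_isLocalization (Submonoid.powers (Polynomial.X : Polynomial (LaurentPolynomial ℂ))) _
  exact MulEquiv.uniqueFactorizationMonoid
    (AddMonoidAlgebra.curryRingEquiv (R := ℂ) (M := ℤ) (N := ℤ)).symm.toMulEquiv this

lemma mem_range_toRational {f : (ToricSurface n).functionField}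
    (hf : ∀ p, Order.coheight (chart (zeroCone n) p) = 1 →
      0 ≤ Scheme.ord f (chart (zeroCone n) p)) : f ∈ Set.range (toRational n) := by
  have : UniqueFactorizationMonoid (ChartRing (zeroCone n).1) :=
    MulEquiv.uniqueFactorizationMonoid (zeroChartEquiv (n := n)).symm.toMulEquiv inferInstance
  obtain ⟨r, rfl⟩ := mem_range_chartToFunctionField (chart (zeroCone n)) hf
  exact ⟨_, (chartToFunctionField_chart _ r).symm⟩

end Torus

section Divisors

lemma coeff_orbitMap (j : Fin (n + 1)) (r : ChartRing (ray j).1) (m : ℤ × ℤ) :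
    (orbitMap j r).coeff m = if pair m j = 0 then (toTorus _ r).coeff m else 0 := by
  induction r using AddMonoidAlgebra.induction_linear with
  | zero => simp
  | add f g hf hg =>
    simp only [map_add, AddMonoidAlgebra.coeff_add, Finsupp.add_apply, hf, hg]
    split_ifs <;> simp
  | single w c =>
    rw [toTorus_single, orbitMap, AddMonoidAlgebra.lift_single]
    rcases eq_or_ne m w with rfl | hw
    · by_cases h : pair (w : ℤ × ℤ) j = 0 <;> simp [h]
    · by_cases h : pair (w : ℤ × ℤ) j = 0 <;> simp [h, Finsupp.single_eq_of_ne hw]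

lemma orbitMap_eq_zero_iff {j : Fin (n + 1)} {r : ChartRing (ray j).1} :
    orbitMap j r = 0 ↔ ∀ m, pair m j = 0 → (toTorus _ r).coeff m = 0 := by
  rw [← AddMonoidAlgebra.coeff_injective.eq_iff, Finsupp.ext_iff]
  simp only [coeff_orbitMap, AddMonoidAlgebra.coeff_zero, Finsupp.coe_zero, Pi.zero_apply,
    ite_eq_right_iff]

/-- The ideal of the torus invariant divisor `D_j` in the chart of a cone which contains `v_j`. -/
noncomputable def orbitIdeal {S : Finset (Fin (n + 1))} (j : S) : Ideal (ChartRing S) :=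
  (RingHom.ker (orbitMap (j : Fin (n + 1)))).comap
    (chartMap (show (ray j.1).1 ⊆ S from Finset.singleton_subset_iff.mpr j.2))

instance orbitIdeal_isPrime {S : Finset (Fin (n + 1))} (j : S) : (orbitIdeal j).IsPrime :=
  have := RingHom.ker_isPrime (orbitMap (j : Fin (n + 1)))
  Ideal.comap_isPrime _ _

lemma mem_orbitIdeal {S : Finset (Fin (n + 1))} {j : S} {r : ChartRing S} :
    r ∈ orbitIdeal j ↔ ∀ m, pair m j.1 = 0 → (toTorus S r).coeff m = 0 := by
  rw [orbitIdeal, Ideal.mem_comap, RingHom.mem_ker, orbitMap_eq_zero_iff, toTorus_chartMap]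

lemma inf_orbitIdeal (S : Finset (Fin (n + 1))) :
    Finset.univ.inf (orbitIdeal : S → Ideal (ChartRing S)) = Ideal.span {chartX S} := by
  ext r
  simp only [Submodule.mem_finsetInf, Finset.mem_univ, true_imp_iff, mem_orbitIdeal, Subtype.forall,
    Ideal.mem_span_singleton, chartX_dvd_iff]

lemma ker_orbitMap (j : Fin (n + 1)) :
    RingHom.ker (orbitMap j) = Ideal.span {chartX (ray j).1} := by
  ext r
  rw [RingHom.mem_ker, orbitMap_eq_zero_iff, Ideal.mem_span_singleton, chartX_dvd_iff]
  simp only [ray, Finset.mem_singleton, forall_eq]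

lemma chart_orbitIdeal {σ : FanCone n} (j : σ.1) :
    chart σ (⟨orbitIdeal j, inferInstance⟩ : PrimeSpectrum (ChartRing σ.1)) =
      divisorPoint (j : Fin (n + 1)) :=
  chart_map (homOfLE (Finset.singleton_subset_iff.mpr j.2 : {j.1} ⊆ σ.1) : ray j.1 ⟶ σ)
    (⟨RingHom.ker (orbitMap j.1), RingHom.ker_isPrime _⟩ : PrimeSpectrum (ChartRing (ray j.1).1))

lemma coheight_divisorPoint (j : Fin (n + 1)) : Order.coheight (divisorPoint j) = 1 := by
  have hne : RingHom.ker (orbitMap j) ≠ ⊤ := (RingHom.ker_isPrime _).ne_top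
  rw [divisorPoint, coheight_eq_height]
  change (RingHom.ker (orbitMap j)).height = 1
  rw [ker_orbitMap, Ne, Ideal.span_singleton_eq_top] at *
  exact Ideal.height_span_singleton_eq_one_of_mem_nonZeroDivisors
    (mem_nonZeroDivisors_of_ne_zero (chartX_ne_zero _)) hne

lemma exists_orbitIdeal_eq {σ : FanCone n} {p : PrimeSpectrum (ChartRing σ.1)}
    (hp : p.asIdeal.height = 1) (hx : chartX σ.1 ∈ p.asIdeal) : ∃ j, orbitIdeal j = p.asIdeal := by
  obtain ⟨j, -, hj⟩ := (Ideal.IsPrime.inf_le' p.isPrime).mp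
    ((inf_orbitIdeal σ.1).trans_le ((Ideal.span_singleton_le_iff_mem _).mpr hx))
  have hheight : (orbitIdeal j).height = 1 := by
    rw [← coheight_divisorPoint j.1, ← chart_orbitIdeal j, coheight_eq_height]
  exact ⟨j, Ideal.eq_of_le_of_height_le _ hj (by rw [hp, hheight])⟩

lemma mem_torus_or_eq_divisorPoint {x : ToricSurface n} (hx : Order.coheight x = 1) :
    (∃ p, x = chart (zeroCone n) p) ∨ ∃ j, x = divisorPoint j := by
  obtain ⟨σ, p, rfl⟩ := Scheme.IsLocallyDirected.ι_jointly_surjective (fanDiagram n) x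
  change PrimeSpectrum (ChartRing σ.1) at p
  change Order.coheight (chart σ p) = 1 at hx
  change (∃ p', chart σ p = chart (zeroCone n) p') ∨ ∃ j, chart σ p = divisorPoint j
  by_cases hp : chartX σ.1 ∈ p.asIdeal
  · obtain ⟨j, hj⟩ := exists_orbitIdeal_eq (coheight_eq_height (chart σ) p ▸ hx) hp
    exact .inr ⟨j, by rw [← chart_orbitIdeal]; exact congrArg _ (PrimeSpectrum.ext hj.symm)⟩
  · obtain ⟨z, rfl⟩ := mem_range_map_zeroConeHom.mpr hp
    exact .inl ⟨z, chart_map _ z⟩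

lemma chart_ne_divisorPoint {σ : FanCone n} {j : Fin (n + 1)} (hj : j ∉ σ.1)
    (p : PrimeSpectrum (ChartRing σ.1)) : chart σ p ≠ divisorPoint j := by
  intro h
  obtain ⟨ρ, f, g, z, -, hz⟩ := (Scheme.IsLocallyDirected.ι_eq_ι_iff (fanDiagram n)).mp h
  have hρ : ρ = zeroCone n := Subtype.ext <| Finset.eq_empty_of_forall_notMem fun i hi => by
    obtain rfl : i = j := Finset.mem_singleton.mp (leOfHom g hi)
    exact hj (leOfHom f hi)
  subst hρ
  refine mem_range_map_zeroConeHom.mp ⟨z, hz⟩ ?_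
  change chartX (ray j).1 ∈ RingHom.ker (orbitMap j)
  rw [ker_orbitMap]
  exact Ideal.mem_span_singleton_self _

lemma divisorPoint_injective : Function.Injective (divisorPoint (n := n)) := fun i j h => by
  by_contra hij
  exact chart_ne_divisorPoint (σ := ray i) (by simpa [ray] using Ne.symm hij) _ h

end Divisors

section OrderOfVanishing

lemma ord_toRational_single_fst (j : Fin (n + 1)) (a : ℤ) :
    Scheme.ord (toRational n (AddMonoidAlgebra.single (a, 0) 1)) (divisorPoint j) = a := by
  have hne (a : ℤ) : toRational n (AddMonoidAlgebra.single (a, 0) 1) ≠ 0 := by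
    rw [map_ne_zero_iff _ toRational_injective]
    simp
  have ord_add (a b : ℤ) :
      Scheme.ord (toRational n (AddMonoidAlgebra.single (a + b, 0) 1)) (divisorPoint j) =
        Scheme.ord (toRational n (AddMonoidAlgebra.single (a, 0) 1)) (divisorPoint j) +
        Scheme.ord (toRational n (AddMonoidAlgebra.single (b, 0) 1)) (divisorPoint j) := by
    rw [← Scheme.ord_mul (hne a) (hne b), ← map_mul, AddMonoidAlgebra.single_mul_single]
    simp
  have ord_one :
      Scheme.ord (toRational n (AddMonoidAlgebra.single (1, 0) 1)) (divisorPoint j) = 1 := by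
    have := ord_chartToFunctionField_of_eq_span (chart (ray j))
      (p := ⟨RingHom.ker (orbitMap j), RingHom.ker_isPrime _⟩) (coheight_divisorPoint j)
      (chartX_ne_zero _) (ker_orbitMap j)
    rwa [chartToFunctionField_chart, chartX, toTorus_single] at this
  have := map_zsmul (AddMonoidHom.mk' (fun a : ℤ =>
    Scheme.ord (toRational n (AddMonoidAlgebra.single (a, 0) 1)) (divisorPoint j)) ord_add) a 1
  simpa [ord_one] using this

lemma exists_ord_toRational_eq (j : Fin (n + 1)) {q : TorusRing} (hq : q ≠ 0) :
    ∃ m₀, q.coeff m₀ ≠ 0 ∧ (∀ m, q.coeff m ≠ 0 → pair m₀ j ≤ pair m j) ∧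
      Scheme.ord (toRational n q) (divisorPoint j) = pair m₀ j := by
  obtain ⟨m₀, hm₀, hmin⟩ := q.coeff.support.exists_min_image (fun m => pair m j)
    (Finsupp.support_nonempty_iff.mpr (AddMonoidAlgebra.coeff_eq_zero.not.mpr hq))
  simp only [Finsupp.mem_support_iff] at hm₀ hmin
  refine ⟨m₀, hm₀, hmin, ?_⟩
  obtain ⟨r, rfl⟩ := exists_eq_single_mul_toTorus (S := (ray j).1) (a := (pair m₀ j, 0)) (q := q)
    fun m hm i hi => by
      obtain rfl := Finset.mem_singleton.mp hi
      have := hmin m hm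
      simp only [pair, Prod.fst_sub, Prod.snd_sub, sub_zero] at this ⊢
      omega
  have hr : r ∉ RingHom.ker (orbitMap j) := fun hr => hm₀ <| by
    rw [AddMonoidAlgebra.coeff_single_mul_apply, one_mul]
    exact orbitMap_eq_zero_iff.mp hr _ (by simp [pair])
  have hne := (map_ne_zero_iff _ (toRational_injective (n := n))).mpr hq
  rw [map_mul] at hne ⊢
  rw [Scheme.ord_mul (left_ne_zero_of_mul hne) (right_ne_zero_of_mul hne),
    ord_toRational_single_fst, ← chartToFunctionField_chart, add_eq_left]
  exact ord_chartToFunctionField_of_notMem (chart (ray j))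
    (p := ⟨RingHom.ker (orbitMap j), RingHom.ker_isPrime _⟩) hr

lemma le_ord_toRational_iff {j : Fin (n + 1)} {a : ℤ} {q : TorusRing} (hq : q ≠ 0) :
    a ≤ Scheme.ord (toRational n q) (divisorPoint j) ↔ ∀ m, q.coeff m ≠ 0 → a ≤ pair m j := by
  obtain ⟨m₀, hm₀, hmin, hord⟩ := exists_ord_toRational_eq j hq
  rw [hord]
  exact ⟨fun h m hm => h.trans (hmin m hm), fun h => h m₀ hm₀⟩

end OrderOfVanishing

section GlobalSections

/-- The coefficient `∑_{i > n - j} b_i (i - (n - j))` of `D(b)` at `D_j`. -/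
def divisorCoeff (b : Fin (n - 1) → ℕ) (j : Fin (n + 1)) : ℤ :=
  ∑ p : Fin (n - 1), (b p : ℤ) * max 0 ((p : ℤ) + 1 - (n - j))

lemma basicDivisor_divisorPoint (p : Fin (n - 1)) (j : Fin (n + 1)) :
    basicDivisor p (divisorPoint j) = max 0 ((p : ℤ) + 1 - (n - j)) := by
  classical
  have hprime (i : ℕ) (hi : i ∈ Finset.range (p + 1)) :
      (((p : ℤ) + 1 - i) • primeDivisor (⟨n - i, by omega⟩ : Fin (n + 1))) (divisorPoint j) =
        if i = n - j then (p : ℤ) + 1 - i else 0 := by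
    have : (⟨n - i, by omega⟩ : Fin (n + 1)) = j ↔ i = n - j := by
      rw [Fin.ext_iff]
      have := Finset.mem_range.mp hi
      grind
    simp only [primeDivisor, Finsupp.smul_apply, Finsupp.single_apply,
      divisorPoint_injective.eq_iff, this, smul_eq_mul, mul_ite, mul_one, mul_zero]
  rw [basicDivisor, Finsupp.finsetSum_apply, Finset.sum_congr rfl hprime, Finset.sum_ite_eq']
  split_ifs with h <;> rw [Finset.mem_range] at h <;> omega

lemma divisor_divisorPoint (b : Fin (n - 1) → ℕ) (j : Fin (n + 1)) :
    divisor b (divisorPoint j) = divisorCoeff b j := by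
  simp only [divisor, divisorCoeff, Finsupp.finsetSum_apply, Finsupp.smul_apply,
    basicDivisor_divisorPoint, smul_eq_mul]

lemma divisor_zeroChart (b : Fin (n - 1) → ℕ)
    (p : Spec (CommRingCat.of (ChartRing (zeroCone n).1))) :
    divisor b (chart (zeroCone n) p) = 0 := by
  have hne (j : Fin (n + 1)) := chart_ne_divisorPoint (σ := zeroCone n) (Finset.notMem_empty j) p
  simp [divisor, basicDivisor, primeDivisor, Finsupp.finsetSum_apply, hne]

lemma mem_globalSections_iff (b : Fin (n - 1) → ℕ) {q : TorusRing} (hq : q ≠ 0) :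
    toRational n q ∈ globalSections (divisor b) ↔
      ∀ m, q.coeff m ≠ 0 → ∀ j, -divisorCoeff b j ≤ pair m j := by
  have hne : toRational n q ≠ 0 := (map_ne_zero_iff _ toRational_injective).mpr hq
  have hdiv (j : Fin (n + 1)) :
      0 ≤ Scheme.ord (toRational n q) (divisorPoint j) + divisor b (divisorPoint j) ↔
        ∀ m, q.coeff m ≠ 0 → -divisorCoeff b j ≤ pair m j := by
    rw [divisor_divisorPoint, ← le_ord_toRational_iff hq, neg_le_iff_add_nonneg]
  constructor
  · intro hf m hm j
    exact (hdiv j).mp (hf.resolve_left hne _ trivial (coheight_divisorPoint j)) m hm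
  · refine fun h => .inr fun x _ hx => ?_
    rcases mem_torus_or_eq_divisorPoint hx with ⟨p, rfl⟩ | ⟨j, rfl⟩
    · rw [divisor_zeroChart, add_zero, ← chartToFunctionField_toZeroChart]
      exact ord_chartToFunctionField_nonneg _ _ _
    · exact (hdiv j).mpr fun m hm => h m hm j

lemma globalSections_divisor (b : Fin (n - 1) → ℕ) :
    globalSections (divisor b) =
      toRational n '' {q | ∀ m, q.coeff m ≠ 0 → ∀ j, -divisorCoeff b j ≤ pair m j} := by
  ext f
  constructor
  · intro hf
    rcases eq_or_ne f 0 with rfl | h0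
    · exact ⟨0, by simp, map_zero _⟩
    obtain ⟨q, rfl⟩ := mem_range_toRational (f := f) fun p hp => by
      simpa [divisor_zeroChart] using hf.resolve_left h0 _ trivial hp
    have hq : q ≠ 0 := fun h => h0 (by rw [h, map_zero])
    exact ⟨q, (mem_globalSections_iff b hq).mp hf, rfl⟩
  · rintro ⟨q, hq, rfl⟩
    rcases eq_or_ne q 0 with rfl | h0
    · exact .inl (map_zero _)
    · exact (mem_globalSections_iff b h0).mpr hq

end GlobalSections

end ToricCharts

section Monomials

open Polynomial

lemma semiconjBy_units_zpow_add {R : Type*} [Ring R] {x : R} {u : Rˣ}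
    (h : SemiconjBy (u : R) (x + 1) x) (a : ℤ) : SemiconjBy (↑(u ^ a) : R) (x + a) x := by
  have hstep (b : ℤ) : SemiconjBy (u : R) (x + (b + 1 : ℤ)) (x + b) := by
    rw [Int.cast_add, Int.cast_one, add_comm (b : R), ← add_assoc]
    exact h.add_right (Int.commute_cast _ b)
  induction a using Int.induction_on with
  | zero => simp
  | succ i ih => simpa [zpow_add] using ih.mul_left (hstep i)
  | pred i ih =>
    have hinv := (hstep (-i - 1)).units_inv_symm_left
    rw [sub_add_cancel] at hinv
    simpa [zpow_sub] using ih.mul_left hinv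

variable (n : ℕ)

lemma yPow_add (a b : ℤ) : yPow n (a + b) = yPow n a * yPow n b := by
  simp [yPow, zpow_add]

lemma yPow_zero : yPow n 0 = 1 := by simp [yPow]

lemma coe_yUnit : (yUnit n : CrossedProduct n) = yPow n 1 := by simp [yPow]

lemma del_mul_yPow_one : del n * yPow n 1 = yPow n 1 * del n + 1 := by
  simpa [yPow, yUnit, del, gen] using toCrossedProduct_rel (Rel.weyl (n := n))

lemma gam_pow : gam n ^ n = 1 := by
  simpa [gam, gen] using toCrossedProduct_rel (Rel.gam_pow (n := n))

lemma yPow_one_mul_gam : yPow n 1 * gam n = rootOfUnity n • (gam n * yPow n 1) := by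
  simpa [yPow, yUnit, gam, gen] using toCrossedProduct_rel (Rel.y_gam (n := n))

lemma gam_mul_del : gam n * del n = rootOfUnity n • (del n * gam n) := by
  simpa [del, gam, gen] using toCrossedProduct_rel (Rel.gam_del (n := n))

lemma rootOfUnity_ne_zero : rootOfUnity n ≠ 0 := Complex.exp_ne_zero _

lemma isPrimitiveRoot_rootOfUnity [NeZero n] : IsPrimitiveRoot (rootOfUnity n) n :=
  Complex.isPrimitiveRoot_exp n (NeZero.ne n)

/-- The Euler operator `y ∂`. -/
noncomputable def euler : CrossedProduct n := yPow n 1 * del n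

lemma del_eq : del n = yPow n (-1) * euler n := by
  rw [euler, ← mul_assoc, ← yPow_add, neg_add_cancel, yPow_zero, one_mul]

lemma euler_mul_yPow (a : ℤ) : euler n * yPow n a = yPow n a * (euler n + (a : ℂ) • 1) := by
  have h : SemiconjBy (yUnit n : CrossedProduct n) (euler n + 1) (euler n) := by
    rw [SemiconjBy, coe_yUnit, euler, mul_assoc, del_mul_yPow_one]
  rw [← Algebra.algebraMap_eq_smul_one, map_intCast]
  exact (semiconjBy_units_zpow_add h a).eq.symm

lemma gam_mul_yPow (a : ℤ) : gam n * yPow n a = rootOfUnity n ^ (-a) • (yPow n a * gam n) := by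
  let ω : ℂˣ := Units.mk0 (rootOfUnity n) (rootOfUnity_ne_zero n)
  let c : (CrossedProduct n)ˣ := Units.map (algebraMap ℂ (CrossedProduct n)) ω⁻¹
  have hc (b : ℤ) : (↑(c ^ b) : CrossedProduct n) = algebraMap ℂ _ (rootOfUnity n ^ (-b)) := by
    simp [c, ω, ← map_zpow]
  have h : SemiconjBy (gam n) (yUnit n) ↑(c * yUnit n) := by
    have h1 := hc 1
    rw [zpow_one, zpow_neg_one] at h1
    rw [SemiconjBy, Units.val_mul, h1, coe_yUnit, ← Algebra.smul_def, smul_mul_assoc,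
      yPow_one_mul_gam, inv_smul_smul₀ (rootOfUnity_ne_zero n)]
  have hcomm : Commute c (yUnit n) := Units.ext (Algebra.commutes _ _)
  have hpow := (h.units_zpow_right a).eq
  rwa [hcomm.mul_zpow, Units.val_mul, hc, ← Algebra.smul_def, smul_mul_assoc] at hpow

lemma commute_gam_euler : Commute (gam n) (euler n) := by
  rw [commute_iff_eq, euler, ← mul_assoc, gam_mul_yPow, smul_mul_assoc, mul_assoc, gam_mul_del,
    mul_smul_comm, smul_smul, mul_assoc, zpow_neg_one, inv_mul_cancel₀ (rootOfUnity_ne_zero n),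
    one_smul]

/-- The operator `y ∂ / n`, which acts on `y ^ (n t)` as `t`. -/
noncomputable def scaledEuler : CrossedProduct n := (n : ℂ)⁻¹ • euler n

lemma commute_gam_aeval (f : ℂ[X]) : Commute (gam n) (aeval (scaledEuler n) f) := by
  have h : Commute (gam n) (scaledEuler n) := (commute_gam_euler n).smul_right _
  rw [aeval_eq_sum_range]
  exact Commute.sum_right _ _ _ fun i _ => (h.pow_right i).smul_right _

lemma commute_idem_aeval (i : ℕ) (f : ℂ[X]) : Commute (idem n i) (aeval (scaledEuler n) f) :=
  (Commute.sum_left _ _ _ fun j _ =>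
    ((commute_gam_aeval n f).smul_left _).pow_left j).smul_left _

/-- The elements `y ^ m f(y ∂ / n) e` of `D e`, linearly in the polynomial `f`. Those with `m`
divisible by `n` lie in `e D e`. -/
noncomputable def mono (m : ℤ) : ℂ[X] →ₗ[ℂ] CrossedProduct n :=
  LinearMap.mulRight ℂ (idem n 0) ∘ₗ LinearMap.mulLeft ℂ (yPow n m) ∘ₗ
    (aeval (scaledEuler n)).toLinearMap

lemma mono_apply (m : ℤ) (f : ℂ[X]) :
    mono n m f = yPow n m * aeval (scaledEuler n) f * idem n 0 := rfl

lemma yPow_mul_mono (a m : ℤ) (f : ℂ[X]) : yPow n a * mono n m f = mono n (a + m) f := by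
  rw [mono_apply, mono_apply, yPow_add, ← mul_assoc, ← mul_assoc]

lemma mono_zero_one : mono n 0 1 = idem n 0 := by simp [mono_apply, yPow_zero]

lemma gam_mul_idem_zero : gam n * idem n 0 = idem n 0 := by
  rw [idem, mul_smul_comm, pow_zero, one_smul]
  congr 1
  have h := mul_geom_sum (gam n) n
  rwa [gam_pow, sub_self, sub_one_mul, sub_eq_zero] at h

lemma gam_mul_mono (m : ℤ) (f : ℂ[X]) :
    gam n * mono n m f = rootOfUnity n ^ (-m) • mono n m f := by
  rw [mono_apply, ← mul_assoc, ← mul_assoc, gam_mul_yPow, smul_mul_assoc, mul_assoc (yPow n m),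
    (commute_gam_aeval n f).eq, smul_mul_assoc, mul_assoc, mul_assoc, gam_mul_idem_zero, mul_assoc]

lemma gam_pow_mul_mono (m : ℤ) (f : ℂ[X]) (c : ℂ) (j : ℕ) :
    (c • gam n) ^ j * mono n m f = (c * rootOfUnity n ^ (-m)) ^ j • mono n m f := by
  induction j with
  | zero => simp
  | succ j ih =>
    rw [pow_succ, mul_assoc, smul_mul_assoc, gam_mul_mono, smul_smul, mul_smul_comm, ih,
      smul_smul, pow_succ, mul_comm]

lemma idem_mul_yPow (p : ℕ) : idem n p * yPow n p = mono n p 1 := by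
  rw [mono_apply, map_one, mul_one, idem, idem, smul_mul_assoc, mul_smul_comm, Finset.sum_mul,
    Finset.mul_sum, pow_zero, one_smul]
  have h : SemiconjBy (yPow n p) (gam n) (rootOfUnity n ^ p • gam n) := by
    rw [SemiconjBy, smul_mul_assoc, gam_mul_yPow, smul_smul, ← zpow_natCast,
      ← zpow_add₀ (rootOfUnity_ne_zero n), add_neg_cancel, zpow_zero, one_smul]
  exact congrArg _ (Finset.sum_congr rfl fun j _ => (h.pow_right j).eq.symm)

variable [NeZero n]

lemma idem_mul_mono (i : ℕ) (m : ℤ) (f : ℂ[X]) :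
    idem n i * mono n m f = if (n : ℤ) ∣ m - i then mono n m f else 0 := by
  have hprim := isPrimitiveRoot_rootOfUnity n
  have hz : rootOfUnity n ^ i * rootOfUnity n ^ (-m) = rootOfUnity n ^ (-(m - i)) := by
    rw [← zpow_natCast, ← zpow_add₀ (rootOfUnity_ne_zero n), neg_sub, sub_eq_add_neg]
  simp only [idem, smul_mul_assoc, Finset.sum_mul, gam_pow_mul_mono, ← Finset.sum_smul, smul_smul,
    hz]
  split_ifs with h
  · rw [(hprim.zpow_eq_one_iff_dvd _).mpr h.neg_right]
    simp
  · have hne : rootOfUnity n ^ (-(m - i)) ≠ 1 := fun hc =>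
      h (dvd_neg.mp ((hprim.zpow_eq_one_iff_dvd _).mp hc))
    have hpow : (rootOfUnity n ^ (-(m - i))) ^ n = 1 := by
      rw [← zpow_natCast, zpow_comm, zpow_natCast, hprim.pow_eq_one, one_zpow]
    rw [geom_sum_eq hne, hpow, sub_self, zero_div, mul_zero, zero_smul]

lemma idem_zero_mul_mono (a : ℤ) (f : ℂ[X]) : idem n 0 * mono n (n * a) f = mono n (n * a) f := by
  rw [idem_mul_mono, if_pos (by simp)]

lemma euler_mul_mono (m : ℤ) (f : ℂ[X]) :
    euler n * mono n m f = mono n m ((C (n : ℂ) * X + C (m : ℂ)) * f) := by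
  have h : euler n + (m : ℂ) • 1 = aeval (scaledEuler n) (C (n : ℂ) * X + C (m : ℂ)) := by
    simp only [map_add, map_mul, aeval_C, aeval_X, scaledEuler, Algebra.algebraMap_eq_smul_one,
      smul_mul_assoc, one_mul, smul_inv_smul₀ (NeZero.ne (n : ℂ))]
  rw [mono_apply, mono_apply, ← mul_assoc, ← mul_assoc, euler_mul_yPow, h, map_mul,
    mul_assoc (yPow n m)]

lemma scaledEuler_mul_mono (m : ℤ) (f : ℂ[X]) :
    scaledEuler n * mono n m f = mono n m ((X + C ((m : ℂ) / n)) * f) := by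
  rw [scaledEuler, smul_mul_assoc, euler_mul_mono, ← map_smul, ← smul_mul_assoc, smul_add,
    smul_eq_C_mul, smul_eq_C_mul, ← mul_assoc, ← C_mul, ← C_mul,
    inv_mul_cancel₀ (NeZero.ne (n : ℂ)), C_1, one_mul, inv_mul_eq_div]

lemma aeval_mul_mono (m : ℤ) (f g : ℂ[X]) :
    aeval (scaledEuler n) f * mono n m g = mono n m (f.comp (X + C ((m : ℂ) / n)) * g) := by
  induction f using Polynomial.induction_on' generalizing g with
  | add p q hp hq => rw [map_add, add_mul, hp, hq, add_comp, add_mul, map_add]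
  | monomial k a =>
    induction k generalizing g with
    | zero => simp [Algebra.algebraMap_eq_smul_one, ← smul_eq_C_mul]
    | succ k ih =>
      rw [← monomial_mul_X, map_mul, aeval_X, mul_assoc, scaledEuler_mul_mono, ih, mul_comp,
        X_comp, mul_assoc]

lemma mono_mul_mono (m a : ℤ) (f g : ℂ[X]) :
    mono n m f * mono n (n * a) g = mono n (m + n * a) (f.comp (X + C (a : ℂ)) * g) := by
  have ha : ((n * a : ℤ) : ℂ) / n = a := by
    rw [Int.cast_mul, Int.cast_natCast, mul_div_cancel_left₀ _ (NeZero.ne (n : ℂ))]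
  rw [mono_apply n m f, mul_assoc, idem_zero_mul_mono, mul_assoc, aeval_mul_mono, yPow_mul_mono,
    ha]

end Monomials

section GradedSpans

open Polynomial

lemma adjoin_mul_mem {R A : Type*} [CommSemiring R] [Semiring A] [Algebra R A] {s : Set A}
    {M : Submodule R A} (h : ∀ x ∈ s, ∀ a ∈ M, x * a ∈ M) {x : A} (hx : x ∈ Algebra.adjoin R s)
    {a : A} (ha : a ∈ M) : x * a ∈ M := by
  induction hx using Algebra.adjoin_induction generalizing a with
  | mem x hx => exact h x hx a ha
  | algebraMap c => rw [← Algebra.smul_def]; exact M.smul_mem c ha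
  | add x y _ _ hx hy => rw [add_mul]; exact add_mem (hx ha) (hy ha)
  | mul x y _ _ hx hy => rw [mul_assoc]; exact hx (hy ha)

variable {n : ℕ}

/-- The `n`-periodic extension of `k` to `ℤ` which vanishes at the multiples of `n`. The operator
`∑ k_i e_i` acts on `y ^ m f(y ∂ / n) e` as its value at `m`. -/
noncomputable def periodicExt (k : Fin (n - 1) → ℂ) (m : ℤ) : ℂ :=
  ∑ p : Fin (n - 1), if (n : ℤ) ∣ m - ((p : ℕ) + 1 : ℕ) then k p else 0

/-- The span of the elements `y ^ m f(y ∂ / n) e` for which `h m` divides `f`. -/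
noncomputable def monoSpan (n : ℕ) (h : ℤ → ℂ[X]) : Submodule ℂ (CrossedProduct n) :=
  Submodule.span ℂ {x | ∃ m f, x = mono n m (h m * f)}

/-- The span of the elements `y ^ (-n a) f(y ∂ / n) e` of `e D e` for which `G a` divides `f`. The
sign makes multiplicities of roots increase with `a`. -/
noncomputable def gradedSpan (n : ℕ) (G : ℤ → ℂ[X]) : Submodule ℂ (CrossedProduct n) :=
  Submodule.span ℂ {x | ∃ a f, x = mono n (n * -a) (G a * f)}

lemma mono_mem_monoSpan {h : ℤ → ℂ[X]} {m : ℤ} {f : ℂ[X]} (hf : h m ∣ f) :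
    mono n m f ∈ monoSpan n h := by
  obtain ⟨g, rfl⟩ := hf
  exact Submodule.subset_span ⟨m, g, rfl⟩

lemma mono_mem_gradedSpan {G : ℤ → ℂ[X]} {a : ℤ} {f : ℂ[X]} (h : G a ∣ f) :
    mono n (n * -a) f ∈ gradedSpan n G := by
  obtain ⟨g, rfl⟩ := h
  exact Submodule.subset_span ⟨a, g, rfl⟩

lemma gradedSpan_le {G G' : ℤ → ℂ[X]} (h : ∀ a, G' a ∣ G a) :
    gradedSpan n G ≤ gradedSpan n G' := by
  refine Submodule.span_le.mpr ?_
  rintro _ ⟨a, f, rfl⟩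
  exact mono_mem_gradedSpan ((h a).mul_right f)

lemma gradedSpan_congr {G G' : ℤ → ℂ[X]} (h : ∀ a, Associated (G a) (G' a)) :
    gradedSpan n G = gradedSpan n G' :=
  le_antisymm (gradedSpan_le fun a => (h a).symm.dvd) (gradedSpan_le fun a => (h a).dvd)

/-- The polynomial by which `d_k ^ (p - m)` takes `y ^ p e` to a multiple of `y ^ m e`. -/
noncomputable def lowering (k : Fin (n - 1) → ℂ) (p m : ℤ) : ℂ[X] :=
  ∏ j ∈ Finset.Ioc m p, (C (n : ℂ) * X + C (j - periodicExt k j))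

lemma lowering_of_le (k : Fin (n - 1) → ℂ) {p m : ℤ} (h : p ≤ m) : lowering k p m = 1 := by
  rw [lowering, Finset.Ioc_eq_empty (not_lt.mpr h), Finset.prod_empty]

lemma lowering_sub_one (k : Fin (n - 1) → ℂ) {p m : ℤ} (h : m ≤ p) :
    lowering k p (m - 1) = (C (n : ℂ) * X + C (m - periodicExt k m)) * lowering k p m := by
  have hIoc : insert m (Finset.Ioc m p) = Finset.Ioc (m - 1) p := by grind
  rw [lowering, lowering, ← hIoc, Finset.prod_insert Finset.left_notMem_Ioc]

lemma lowering_sub_one_dvd (k : Fin (n - 1) → ℂ) (p m : ℤ) :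
    lowering k p (m - 1) ∣ (C (n : ℂ) * X + C (m - periodicExt k m)) * lowering k p m := by
  rcases le_or_gt m p with h | h
  · rw [lowering_sub_one k h]
  · rw [lowering_of_le k (by omega)]
    exact one_dvd _

lemma lowering_add_one_dvd (k : Fin (n - 1) → ℂ) (p m : ℤ) :
    lowering k p (m + 1) ∣ lowering k p m :=
  Finset.prod_dvd_prod_of_subset _ _ _ (Finset.Ioc_subset_Ioc_left (by omega))

variable [NeZero n]

lemma dunkl_mul_mono (k : Fin (n - 1) → ℂ) (m : ℤ) (f : ℂ[X]) :
    dunkl k * mono n m f = mono n (m - 1) ((C (n : ℂ) * X + C (m - periodicExt k m)) * f) := by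
  have hidem : (∑ p : Fin (n - 1), k p • idem n (p + 1)) * mono n m f =
      periodicExt k m • mono n m f := by
    simp only [periodicExt, Finset.sum_mul, Finset.sum_smul, smul_mul_assoc, idem_mul_mono,
      smul_ite, ite_smul, smul_zero, zero_smul]
  rw [dunkl, sub_mul, mul_assoc, hidem, del_eq, mul_assoc, euler_mul_mono, mul_smul_comm,
    yPow_mul_mono, yPow_mul_mono, ← map_smul, ← map_sub, smul_eq_C_mul, ← sub_mul, add_sub_assoc,
    ← C_sub, neg_add_eq_sub]

lemma algH_mul_mem_monoSpan (k : Fin (n - 1) → ℂ) (p : ℤ) {x : CrossedProduct n}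
    (hx : x ∈ algH k) {s : CrossedProduct n} (hs : s ∈ monoSpan n (lowering k p)) :
    x * s ∈ monoSpan n (lowering k p) := by
  refine adjoin_mul_mem (fun x hx => ?_) hx hs
  change monoSpan n (lowering k p) ≤ (monoSpan n (lowering k p)).comap (LinearMap.mulLeft ℂ x)
  refine Submodule.span_le.mpr ?_
  rintro _ ⟨m, f, rfl⟩
  change x * mono n m _ ∈ monoSpan n _
  rcases hx with rfl | rfl | rfl
  · rw [dunkl_mul_mono, ← mul_assoc]
    exact mono_mem_monoSpan ((lowering_sub_one_dvd k p m).mul_right f)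
  · rw [yPow_mul_mono, add_comm]
    exact mono_mem_monoSpan ((lowering_add_one_dvd k p m).mul_right f)
  · rw [gam_mul_mono]
    exact Submodule.smul_mem _ _ (mono_mem_monoSpan (dvd_mul_right _ _))

lemma mono_mem_of_stable {k : Fin (n - 1) → ℂ} {p : ℤ} {M : Submodule ℂ (CrossedProduct n)}
    (hy : ∀ s ∈ M, yPow n 1 * s ∈ M) (hd : ∀ s ∈ M, dunkl k * s ∈ M) (hp : mono n p 1 ∈ M)
    (f : ℂ[X]) : mono n p f ∈ M := by
  have hX (g : ℂ[X]) (hg : mono n p g ∈ M) : mono n p (X * g) ∈ M := by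
    have h := hy _ (hd _ hg)
    rw [dunkl_mul_mono, yPow_mul_mono, add_sub_cancel, add_mul, map_add, ← smul_eq_C_mul,
      ← smul_eq_C_mul, smul_mul_assoc, map_smul, map_smul,
      M.add_mem_iff_left (M.smul_mem _ hg)] at h
    exact (M.smul_mem_iff (NeZero.ne (n : ℂ))).mp h
  induction f using Polynomial.induction_on' with
  | add f g hf hg => rw [map_add]; exact add_mem hf hg
  | monomial i c =>
    rw [← C_mul_X_pow_eq_monomial, ← smul_eq_C_mul, map_smul]
    refine M.smul_mem c ?_
    induction i with
    | zero => simpa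
    | succ i ih => rw [pow_succ']; exact hX _ ih

lemma monoSpan_le_of_stable {k : Fin (n - 1) → ℂ} {p : ℤ} {M : Submodule ℂ (CrossedProduct n)}
    (hy : ∀ s ∈ M, yPow n 1 * s ∈ M) (hd : ∀ s ∈ M, dunkl k * s ∈ M) (hp : mono n p 1 ∈ M) :
    monoSpan n (lowering k p) ≤ M := by
  have hbase := mono_mem_of_stable hy hd hp
  refine Submodule.span_le.mpr ?_
  rintro _ ⟨m, f, rfl⟩
  change mono n m _ ∈ M
  rcases le_total p m with h | h
  · rw [lowering_of_le k h, one_mul]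
    induction m, h using Int.leInduction with
    | base => exact hbase f
    | succ m _ ih => simpa [yPow_mul_mono, add_comm] using hy _ ih
  · induction m, h using Int.leInductionDown with
    | base => exact hbase _
    | pred m hm ih => simpa only [lowering_sub_one k hm, dunkl_mul_mono, mul_assoc] using hd _ ih

lemma map_mulRight_algH (k : Fin (n - 1) → ℂ) (p : ℤ) :
    (Subalgebra.toSubmodule (algH k)).map (LinearMap.mulRight ℂ (mono n p 1)) =
      monoSpan n (lowering k p) := by
  apply le_antisymm
  · rw [Submodule.map_le_iff_le_comap]
    intro x hx
    exact algH_mul_mem_monoSpan k p hx (mono_mem_monoSpan (lowering_of_le k le_rfl).dvd)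
  · have hstable {x : CrossedProduct n} (hx : x ∈ algH k) :
        ∀ s ∈ (Subalgebra.toSubmodule (algH k)).map (LinearMap.mulRight ℂ (mono n p 1)),
          x * s ∈ (Subalgebra.toSubmodule (algH k)).map (LinearMap.mulRight ℂ (mono n p 1)) := by
      rintro _ ⟨z, hz, rfl⟩
      exact ⟨x * z, (algH k).mul_mem hx hz, mul_assoc _ _ _⟩
    exact monoSpan_le_of_stable (hstable (Algebra.subset_adjoin (by simp)))
      (hstable (Algebra.subset_adjoin (by simp))) ⟨1, (algH k).one_mem, one_mul _⟩

lemma map_mulLeft_idem_monoSpan (h : ℤ → ℂ[X]) :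
    (monoSpan n h).map (LinearMap.mulLeft ℂ (idem n 0)) = gradedSpan n fun a => h (n * -a) := by
  apply le_antisymm
  · rw [Submodule.map_le_iff_le_comap]
    refine Submodule.span_le.mpr ?_
    rintro _ ⟨m, f, rfl⟩
    change idem n 0 * mono n m _ ∈ gradedSpan n _
    rw [idem_mul_mono]
    split_ifs with hm
    · obtain ⟨a, rfl⟩ : (n : ℤ) ∣ m := by simpa using hm
      rw [← neg_neg a]
      exact mono_mem_gradedSpan (dvd_mul_right _ _)
    · exact zero_mem _
  · refine Submodule.span_le.mpr ?_
    rintro _ ⟨a, f, rfl⟩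
    exact ⟨_, mono_mem_monoSpan (dvd_mul_right _ f), idem_zero_mul_mono n (-a) _⟩

lemma sandwich_algH (k : Fin (n - 1) → ℂ) (p : ℤ) :
    sandwich (idem n 0) (Subalgebra.toSubmodule (algH k)) (mono n p 1) =
      gradedSpan n fun a => lowering k p (n * -a) := by
  rw [sandwich, ← Module.End.mul_eq_comp,
    ← (LinearMap.commute_mulLeft_right (R := ℂ) (idem n 0) (mono n p 1)).eq,
    Module.End.mul_eq_comp, Submodule.map_comp, map_mulRight_algH, map_mulLeft_idem_monoSpan]

lemma spherical_eq (k : Fin (n - 1) → ℂ) :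
    spherical k = gradedSpan n fun a => lowering k 0 (n * -a) := by
  rw [spherical, ← sandwich_algH, mono_zero_one]

lemma basicBimodule_eq (k : Fin (n - 1) → ℂ) (p : Fin (n - 1)) :
    basicBimodule k p = gradedSpan n fun a => lowering (k + wVec p) ((p : ℤ) + 1) (n * -a) := by
  rw [← sandwich_algH, basicBimodule]
  exact congrArg _ (idem_mul_yPow n (p + 1))

end GradedSpans

section ShiftProducts

open Polynomial

/-- The polynomial with the simple roots `α + q`, `s ≤ q < t`. -/
noncomputable def shiftProd {R : Type*} [CommRing R] (α : R) (s t : ℤ) : R[X] :=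
  ∏ q ∈ Finset.Ico s t, (X - C (α + q))

section CommRing

variable {R : Type*} [CommRing R] (α : R)

lemma shiftProd_of_le {s t : ℤ} (h : t ≤ s) : shiftProd α s t = 1 := by
  rw [shiftProd, Finset.Ico_eq_empty (not_lt.mpr h), Finset.prod_empty]

lemma shiftProd_mul {s t u : ℤ} (h : s ≤ t) (h' : t ≤ u) :
    shiftProd α s t * shiftProd α t u = shiftProd α s u := by
  rw [shiftProd, shiftProd, shiftProd, ← Finset.prod_union, Finset.Ico_union_Ico_eq_Ico h h']
  exact Finset.Ico_disjoint_Ico_consecutive s t u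

lemma shiftProd_add (s t b : ℤ) : shiftProd (α + b) s t = shiftProd α (s + b) (t + b) := by
  rw [shiftProd, shiftProd, ← Finset.image_add_right_Ico, Finset.prod_image (by simp)]
  simp only [Int.cast_add, add_assoc, add_comm]

lemma shiftProd_comp (s t b : ℤ) :
    (shiftProd α s t).comp (X - C (b : R)) = shiftProd α (s + b) (t + b) := by
  rw [← shiftProd_add, shiftProd, shiftProd, prod_comp]
  simp only [sub_comp, X_comp, C_comp, sub_sub, ← C_add, add_right_comm, add_comm (b : R)]

lemma shiftProd_mul_shiftProd_zero (x L : ℤ) :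
    shiftProd α x L * shiftProd α 0 x =
      shiftProd α 0 L * (shiftProd α (max 0 L) x * shiftProd α x (min 0 L)) := by
  rcases le_total L 0 with hL | hL
  · rw [max_eq_left hL, min_eq_right hL, shiftProd_of_le α hL, one_mul, mul_comm]
  rw [max_eq_right hL, min_eq_left hL]
  rcases le_total x 0 with h0 | h0
  · rw [shiftProd_of_le α h0, shiftProd_of_le α (h0.trans hL), ← shiftProd_mul α h0 hL]
    ring
  rw [shiftProd_of_le α h0]
  rcases le_total x L with h | h
  · rw [shiftProd_of_le α h, ← shiftProd_mul α h0 h]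
    ring
  · rw [shiftProd_of_le α h, ← shiftProd_mul α hL h]
    ring

lemma eval_shiftProd_ne_zero [IsDomain R] {α c : R} {s t : ℤ}
    (h : ∀ q : ℤ, c = α + q → s ≤ q → t ≤ q) : (shiftProd α s t).eval c ≠ 0 := by
  rw [shiftProd, eval_prod, Finset.prod_ne_zero_iff]
  intro q hq
  rw [Finset.mem_Ico] at hq
  rw [eval_sub, eval_X, eval_C, sub_ne_zero]
  exact fun hc => hq.2.not_ge (h q hc hq.1)

/-- The product of the polynomials `shiftProd (α i) 0 (a + m i)`. With `α` the parameters and `m`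
the multiplicities of a bimodule, `y ^ (-n a) G(y ∂ / n) e` generates its component of degree
`-n a` when `G` is this polynomial. -/
noncomputable def rootProd {ι : Type*} [Fintype ι] (α : ι → R) (m : ι → ℕ) (a : ℤ) : R[X] :=
  ∏ i, shiftProd (α i) 0 (a + m i)

lemma rootProd_comp_mul {ι : Type*} [Fintype ι] (α : ι → R) (m₁ m₂ : ι → ℕ) (a b : ℤ) :
    (rootProd (fun i => α i + m₁ i) m₂ a).comp (X - C (b : R)) * rootProd α m₁ b =
      rootProd α (m₁ + m₂) (a + b) *
        ∏ i, (shiftProd (α i) (max 0 (a + b + (m₁ i + m₂ i))) (b + m₁ i) *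
          shiftProd (α i) (b + m₁ i) (min 0 (a + b + (m₁ i + m₂ i)))) := by
  rw [rootProd, rootProd, rootProd, prod_comp, ← Finset.prod_mul_distrib,
    ← Finset.prod_mul_distrib]
  refine Finset.prod_congr rfl fun i _ => ?_
  rw [shiftProd_comp, ← Int.cast_natCast (m₁ i), shiftProd_add, Pi.add_apply, Nat.cast_add,
    ← shiftProd_mul_shiftProd_zero, zero_add]
  congr 2
  ring

end CommRing

/-- Dominance of a family of parameters: an integral difference of a parameter and a later one is
positive. -/
def DominantParam {R ι : Type*} [Ring R] [LT ι] (α : ι → R) : Prop :=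
  ∀ i j, i < j → ∀ z : ℤ, α i - α j = z → 0 < z

section Dominance

variable {R ι : Type*} [Ring R] [LinearOrder ι] {α : ι → R} {m : ι → ℕ}

lemma DominantParam.add (h : DominantParam α) (hm : Antitone m) :
    DominantParam fun i => α i + m i := by
  intro i j hij z hz
  have h1 := h i j hij (z - m i + m j) (by
    push_cast
    rw [← hz, sub_add, sub_sub_sub_comm, add_sub_cancel_right]
    simp)
  have h2 : m j ≤ m i := hm hij.le
  omega

lemma exists_threshold {S : Finset ι} {u : ι → ℤ} (hu : StrictMonoOn u S) (hm : Antitone m) :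
    ∃ b : ℤ, ∀ i ∈ S, b + m i ≤ u i ↔ 0 ≤ u i := by
  rcases (S.filter (u · < 0)).eq_empty_or_nonempty with hneg | hneg
  · obtain ⟨b, hb⟩ := (S.image fun i => u i - m i).bddBelow
    refine ⟨b, fun i hi => iff_of_true ?_ ?_⟩
    · exact le_sub_iff_add_le.mp (hb (Finset.mem_coe.mpr (Finset.mem_image_of_mem _ hi)))
    · simpa using Finset.filter_eq_empty_iff.mp hneg hi
  · obtain ⟨i₀, hi₀, hmax⟩ : ∃ i₀ ∈ S.filter (u · < 0), ∀ i ∈ S.filter (u · < 0), i ≤ i₀ :=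
      ⟨_, Finset.max'_mem _ hneg, Finset.le_max' _⟩
    simp only [Finset.mem_filter] at hi₀ hmax
    refine ⟨u i₀ - m i₀ + 1, fun i hi => ?_⟩
    rcases le_or_gt i i₀ with h | h
    · have hu' := hu.monotoneOn hi hi₀.1 h
      have hm' := hm h
      omega
    · have hu' := hu hi₀.1 hi h
      have hm' := hm h.le
      have hpos : ¬ u i < 0 := fun hui => h.not_ge (hmax i ⟨hi, hui⟩)
      omega

lemma DominantParam.exists_threshold [CharZero R] [Finite ι] (h : DominantParam α)
    (hm : Antitone m) (c : R) :
    ∃ b : ℤ, ∀ i, ∀ q : ℤ, c = α i + q → (b + m i ≤ q ↔ 0 ≤ q) := by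
  classical
  have := Fintype.ofFinite ι
  let S := Finset.univ.filter fun i => ∃ q : ℤ, c = α i + q
  have hS : ∀ i ∈ S, ∃ q : ℤ, c = α i + q := fun i hi => (Finset.mem_filter.mp hi).2
  choose! u hu using hS
  have humono : StrictMonoOn u S := fun i hi j hj hij => by
    have := h i j hij (u j - u i) (by
      rw [Int.cast_sub, sub_eq_sub_iff_add_eq_add, ← hu i hi, add_comm, ← hu j hj])
    omega
  obtain ⟨b, hb⟩ := Kleinian.exists_threshold humono hm
  refine ⟨b, fun i q hq => ?_⟩
  have hi : i ∈ S := Finset.mem_filter.mpr ⟨Finset.mem_univ i, q, hq⟩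
  have hqu : q = u i := Int.cast_injective (add_left_cancel (hq.symm.trans (hu i hi)))
  rw [hqu]
  exact hb i hi

end Dominance

lemma span_eq_top_of_forall_exists_eval_ne_zero {K : Type*} [Field K] [IsAlgClosed K]
    {S : Set K[X]} (h : ∀ c, ∃ Q ∈ S, Q.eval c ≠ 0) : Ideal.span S = ⊤ := by
  obtain ⟨g, hg⟩ := (IsPrincipalIdealRing.principal (Ideal.span S)).principal
  rw [← Ideal.span] at hg
  rw [hg, Ideal.span_singleton_eq_top]
  by_contra hunit
  obtain ⟨c, hc⟩ := IsAlgClosed.exists_root g fun hd => hunit (isUnit_iff_degree_eq_zero.mpr hd)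
  obtain ⟨Q, hQS, hQc⟩ := h c
  have hgQ : g ∣ Q := Ideal.mem_span_singleton.mp (hg ▸ Ideal.subset_span hQS)
  exact hQc (eval_eq_zero_of_dvd_of_eval_eq_zero hgQ hc)

variable {n : ℕ} [NeZero n]

lemma mono_neg_mul_mono_neg (a b : ℤ) (f g : ℂ[X]) :
    mono n (n * -a) f * mono n (n * -b) g =
      mono n (n * -(a + b)) (f.comp (X - C (b : ℂ)) * g) := by
  rw [mono_mul_mono, ← mul_add, ← neg_add, Int.cast_neg, C_neg, ← sub_eq_add_neg]

lemma gradedSpan_mul {G₁ G₂ G : ℤ → ℂ[X]}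
    (hdvd : ∀ a b, G (a + b) ∣ (G₂ a).comp (X - C (b : ℂ)) * G₁ b)
    (hcop : ∀ a (c : ℂ), ∃ b Q, (G₂ (a - b)).comp (X - C (b : ℂ)) * G₁ b = G a * Q ∧
      Q.eval c ≠ 0) :
    gradedSpan n G₂ * gradedSpan n G₁ = gradedSpan n G := by
  apply le_antisymm
  · rw [gradedSpan, gradedSpan, Submodule.span_mul_span, Submodule.span_le]
    rintro _ ⟨_, ⟨a, f, rfl⟩, _, ⟨b, g, rfl⟩, rfl⟩
    change mono n _ _ * mono n _ _ ∈ gradedSpan n G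
    rw [mono_neg_mul_mono_neg, mul_comp]
    exact mono_mem_gradedSpan
      ((hdvd a b).trans (mul_dvd_mul (dvd_mul_right _ _) (dvd_mul_right _ _)))
  · refine Submodule.span_le.mpr ?_
    rintro _ ⟨a, f, rfl⟩
    let S : Set ℂ[X] := {Q | ∃ b, (G₂ (a - b)).comp (X - C (b : ℂ)) * G₁ b = G a * Q}
    have hS : Ideal.span S = ⊤ := span_eq_top_of_forall_exists_eval_ne_zero fun c =>
      let ⟨b, Q, hQ, hQc⟩ := hcop a c
      ⟨Q, ⟨b, hQ⟩, hQc⟩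
    have h1 : (1 : ℂ[X]) ∈ Ideal.span S := hS ▸ Submodule.mem_top
    obtain ⟨_, c, Q, hsum⟩ := Submodule.mem_span_set'.mp h1
    rw [← one_mul f, ← hsum, Finset.sum_mul, Finset.mul_sum, map_sum]
    refine sum_mem fun i _ => ?_
    obtain ⟨b, hb⟩ := (Q i).2
    have hterm : mono n (n * -a) (G a * (c i • (Q i : ℂ[X]) * f)) =
        mono n (n * -(a - b)) (G₂ (a - b)) * mono n (n * -b) (G₁ b * (c i * f)) := by
      rw [mono_neg_mul_mono_neg, sub_add_cancel, ← mul_assoc _ (G₁ b), hb, smul_eq_mul]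
      congr 1
      ring
    rw [hterm]
    exact Submodule.mul_mem_mul (mono_mem_gradedSpan dvd_rfl)
      (mono_mem_gradedSpan (dvd_mul_right _ _))

lemma gradedSpan_rootProd_mul {ι : Type*} [Fintype ι] [LinearOrder ι] {α : ι → ℂ}
    (h : DominantParam α) {m₁ : ι → ℕ} (hm : Antitone m₁) (m₂ : ι → ℕ) :
    gradedSpan n (rootProd (fun i => α i + m₁ i) m₂) * gradedSpan n (rootProd α m₁) =
      gradedSpan n (rootProd α (m₁ + m₂)) := by
  refine gradedSpan_mul (fun a b => ⟨_, rootProd_comp_mul α m₁ m₂ a b⟩) fun a c => ?_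
  obtain ⟨b, hb⟩ := h.exists_threshold hm c
  refine ⟨b, _, by rw [rootProd_comp_mul, sub_add_cancel], ?_⟩
  rw [eval_prod, Finset.prod_ne_zero_iff]
  intro i _
  rw [eval_mul]
  refine mul_ne_zero (eval_shiftProd_ne_zero fun q hq hle => ?_)
    (eval_shiftProd_ne_zero fun q hq hle => ?_)
  · exact (hb i q hq).mpr (le_of_max_le_left hle)
  · exact (min_le_left _ _).trans ((hb i q hq).mp hle)

end ShiftProducts

section Bimodules

open Polynomial

variable {n : ℕ}

/-- The parameters `a_1, …, a_n`. -/
noncomputable def rootParam (k : Fin (n - 1) → ℂ) (i : Fin n) : ℂ := aVec k (i + 1)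

lemma dominantParam_rootParam {k : Fin (n - 1) → ℂ} (hk : IsDominant k) :
    DominantParam (rootParam k) := fun i j hij z hz =>
  hk (i + 1) (j + 1) (by omega) (Nat.succ_lt_succ hij) j.2 z hz

lemma periodicExt_eq (k : Fin (n - 1) → ℂ) (i : Fin n) (s : ℤ) :
    periodicExt k (i + 1 + n * s) = if h : (i : ℕ) < n - 1 then k ⟨i, h⟩ else 0 := by
  have hdvd (p : Fin (n - 1)) :
      (n : ℤ) ∣ i + 1 + n * s - ((p : ℕ) + 1 : ℕ) ↔ (p : ℕ) = i := by
    rw [show (i : ℤ) + 1 + n * s - ((p : ℕ) + 1 : ℕ) = (i - p : ℤ) + n * s by push_cast; ring,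
      Int.dvd_add_left (dvd_mul_right _ _), ← Int.modEq_iff_dvd, Int.natCast_modEq_iff]
    exact ⟨fun h => h.eq_of_lt_of_lt (by omega) i.2, fun h => h ▸ rfl⟩
  simp only [periodicExt, hdvd]
  split_ifs with h
  · rw [Finset.sum_eq_single ⟨i, h⟩ (fun p _ hp => if_neg fun he => hp (Fin.ext he)) (by simp),
      if_pos rfl]
  · exact Finset.sum_eq_zero fun p _ => if_neg (by omega)

/-- The number of the vectors `w_p` in the list whose entry at `i` does not vanish. -/
def listMult (l : List (Fin (n - 1))) (i : Fin n) : ℕ := l.countP fun p : Fin (n - 1) => (i : ℕ) ≤ p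

lemma listMult_singleton (p : Fin (n - 1)) (i : Fin n) :
    listMult [p] i = if (i : ℕ) < (p + 1 : ℕ) then 1 else 0 := by
  simp [listMult, List.countP_cons]

lemma listMult_cons (p : Fin (n - 1)) (l : List (Fin (n - 1))) :
    listMult (p :: l) = listMult [p] + listMult l := by
  ext i
  exact List.countP_append (l₁ := [p])

lemma listMult_antitone (l : List (Fin (n - 1))) : Antitone (listMult l) := fun i j hij =>
  List.countP_mono_left fun p _ h => by
    simp only [decide_eq_true_eq] at h ⊢
    exact le_trans hij h

lemma mem_Ioc_iff_of_fin {p : ℕ} (hp : p ≤ n) (a s : ℤ) (i : Fin n) :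
    (i : ℤ) + 1 + n * s ∈ Finset.Ioc (n * -a) p ↔
      -a ≤ s ∧ s < (if (i : ℕ) < p then 1 else 0 : ℕ) := by
  have hi := i.2
  rw [Finset.mem_Ioc]
  refine and_congr ⟨fun h => ?_, fun h => ?_⟩ ?_
  · by_contra! hs
    nlinarith
  · nlinarith
  · split_ifs <;> refine ⟨fun h => ?_, fun h => ?_⟩
    · by_contra! hs
      push_cast at hs
      nlinarith
    · push_cast at h
      nlinarith
    · by_contra! hs
      push_cast at hs
      nlinarith
    · push_cast at h
      nlinarith

variable [NeZero n]

lemma mul_rootParam (k : Fin (n - 1) → ℂ) (i : Fin n) :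
    (n : ℂ) * rootParam k i = n - (i + 1) + if h : (i : ℕ) < n - 1 then k ⟨i, h⟩ else 0 := by
  rw [rootParam, aVec]
  by_cases h : (i : ℕ) < n - 1
  · rw [dif_pos ⟨by omega, by omega⟩, dif_pos h, mul_div_cancel₀ _ (NeZero.ne (n : ℂ))]
    simp
  · have hn : n = (i : ℕ) + 1 := by omega
    rw [dif_neg (by omega), dif_neg h, mul_zero, add_zero, eq_comm, sub_eq_zero]
    exact_mod_cast hn

lemma rootParam_add_wVec (k : Fin (n - 1) → ℂ) (p : Fin (n - 1)) :
    rootParam (k + wVec p) = fun i => rootParam k i + listMult [p] i := by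
  ext i
  apply mul_left_cancel₀ (NeZero.ne (n : ℂ))
  rw [mul_add, mul_rootParam, mul_rootParam, listMult_singleton]
  by_cases h : (i : ℕ) < n - 1
  · simp only [dif_pos h, Pi.add_apply, wVec, Fin.le_def, Nat.lt_succ_iff]
    split_ifs <;> push_cast <;> ring
  · rw [dif_neg h, dif_neg h, if_neg (by omega), Nat.cast_zero, mul_zero, add_zero, add_zero]

lemma associated_lowering_factor (k : Fin (n - 1) → ℂ) (i : Fin n) (s : ℤ) :
    Associated
      (C (n : ℂ) * X + C (((i + 1 + n * s : ℤ) : ℂ) - periodicExt k (i + 1 + n * s)))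
      (X - C (rootParam k i - 1 - s)) := by
  have h : ((i + 1 + n * s : ℤ) : ℂ) - periodicExt k (i + 1 + n * s) =
      -(n * (rootParam k i - 1 - s)) := by
    rw [mul_sub, mul_sub, mul_rootParam, periodicExt_eq]
    push_cast
    ring
  rw [h, C_neg, C_mul, ← sub_eq_add_neg, ← mul_sub]
  exact associated_unit_mul_left _ _ (isUnit_C.mpr (NeZero.ne (n : ℂ)).isUnit)

lemma prod_Ioc_eq_prod_fin {M : Type*} [CommMonoid M] (f : ℤ → M) {p : ℕ} (hp : p ≤ n) (a : ℤ) :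
    ∏ j ∈ Finset.Ioc (n * -a) (p : ℤ), f j =
      ∏ i : Fin n, ∏ s ∈ Finset.Ico (-a) (if (i : ℕ) < p then 1 else 0 : ℕ),
        f (i + 1 + n * s) := by
  rw [Finset.prod_sigma']
  symm
  refine Finset.prod_bij (fun x _ => (x.1 : ℤ) + 1 + n * x.2) ?_ ?_ ?_ fun _ _ => rfl
  · rintro ⟨i, s⟩ hs
    exact (mem_Ioc_iff_of_fin hp a s i).mpr (by simpa using hs)
  · rintro ⟨i, s⟩ _ ⟨i', s'⟩ _ h
    have heq : (s, i) = (s', i') := (Int.divModEquiv n).symm.injective (by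
      change s * n + (i : ℤ) = s' * n + (i' : ℤ)
      linarith)
    obtain ⟨rfl, rfl⟩ := Prod.mk.inj heq
    rfl
  · intro j hj
    obtain ⟨⟨s, i⟩, h⟩ := (Int.divModEquiv n).symm.surjective (j - 1)
    replace h : s * n + (i : ℤ) = j - 1 := h
    obtain rfl : (i : ℤ) + 1 + n * s = j := by linarith
    exact ⟨⟨i, s⟩, by simpa using (mem_Ioc_iff_of_fin hp a s i).mp hj, rfl⟩

lemma associated_lowering (k : Fin (n - 1) → ℂ) {p : ℕ} (hp : p ≤ n) (a : ℤ) :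
    Associated (lowering k p (n * -a))
      (rootProd (fun i => rootParam k i - (if (i : ℕ) < p then 1 else 0 : ℕ))
        (fun i => if (i : ℕ) < p then 1 else 0) a) := by
  rw [lowering, prod_Ioc_eq_prod_fin _ hp]
  refine Associated.prod _ _ _ fun i _ => ?_
  beta_reduce
  generalize (if (i : ℕ) < p then 1 else 0 : ℕ) = m
  have hreflect : shiftProd (rootParam k i - m) 0 (a + m) =
      ∏ s ∈ Finset.Ico (-a) m, (X - C (rootParam k i - 1 - s)) := by
    refine Finset.prod_nbij' (fun q => m - 1 - q) (fun s => m - 1 - s) ?_ ?_ ?_ ?_ fun q _ => ?_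
    any_goals grind
    push_cast
    congr 2
    ring
  rw [hreflect]
  exact Associated.prod _ _ _ fun s _ => associated_lowering_factor k i s

lemma spherical_eq_gradedSpan (k : Fin (n - 1) → ℂ) :
    spherical k = gradedSpan n (rootProd (rootParam k) 0) := by
  rw [spherical_eq]
  refine gradedSpan_congr fun a => ?_
  simpa [Pi.zero_def] using associated_lowering k (Nat.zero_le n) a

lemma basicBimodule_eq_gradedSpan (k : Fin (n - 1) → ℂ) (p : Fin (n - 1)) :
    basicBimodule k p = gradedSpan n (rootProd (rootParam k) (listMult [p])) := by
  rw [basicBimodule_eq]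
  refine gradedSpan_congr fun a => ?_
  have h := associated_lowering (k + wVec p) (p := p + 1) (by omega) a
  simp only [← listMult_singleton, rootParam_add_wVec, add_sub_cancel_right] at h
  exact_mod_cast h

theorem bimodule_eq_gradedSpan (l : List (Fin (n - 1))) (k : Fin (n - 1) → ℂ)
    (hk : DominantParam (rootParam k)) :
    bimodule k l = gradedSpan n (rootProd (rootParam k) (listMult l)) := by
  induction l generalizing k with
  | nil => exact spherical_eq_gradedSpan k
  | cons p l ih =>
    have hdom : DominantParam (rootParam (k + wVec p)) :=
      rootParam_add_wVec k p ▸ hk.add (listMult_antitone [p])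
    rw [bimodule, ih _ hdom, basicBimodule_eq_gradedSpan, rootParam_add_wVec,
      gradedSpan_rootProd_mul hk (listMult_antitone [p]), listMult_cons p l]

end Bimodules

section Representation

open Polynomial

variable (n : ℕ)

/-- The action of the generators on formal series `∑ φ(m) y ^ m`, where `γ` multiplies `y ^ m` by
`ω ^ (-m)`. -/
noncomputable def seriesGen : Gen → Module.End ℂ (ℤ → ℂ)
  | Gen.y => LinearMap.funLeft ℂ ℂ (· - 1)
  | Gen.yinv => LinearMap.funLeft ℂ ℂ (· + 1)
  | Gen.del => LinearMap.mulLeft ℂ (fun m : ℤ => (m : ℂ) + 1) * LinearMap.funLeft ℂ ℂ (· + 1)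
  | Gen.gam => LinearMap.mulLeft ℂ fun m => rootOfUnity n ^ (-m)

variable [NeZero n]

lemma rootOfUnity_zpow_neg_mul (t : ℤ) : rootOfUnity n ^ (-(n * t)) = 1 :=
  ((isPrimitiveRoot_rootOfUnity n).zpow_eq_one_iff_dvd _).mpr (dvd_neg.mpr (dvd_mul_right _ _))

lemma lift_seriesGen_eq_of_rel ⦃s t : FreeAlgebra ℂ Gen⦄ (h : Rel n s t) :
    FreeAlgebra.lift ℂ (seriesGen n) s = FreeAlgebra.lift ℂ (seriesGen n) t := by
  have hω (m : ℤ) : rootOfUnity n ^ (-m) = rootOfUnity n * rootOfUnity n ^ (-(m + 1)) := by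
    rw [← zpow_one_add₀ (rootOfUnity_ne_zero n)]
    congr 1
    ring
  refine LinearMap.ext fun φ => funext fun m => ?_
  induction h with simp only [map_mul, map_add, map_one, map_pow, map_smul,
    FreeAlgebra.lift_ι_apply, seriesGen]
  | y_yinv => exact congrArg φ (sub_add_cancel m 1)
  | yinv_y => exact congrArg φ (add_sub_cancel_right m 1)
  | weyl =>
    change (m + 1) * φ (m + 1 - 1) = ((m - 1 : ℤ) + 1) * φ (m - 1 + 1) + φ m
    rw [add_sub_cancel_right, sub_add_cancel]
    push_cast
    ring
  | gam_pow =>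
    rw [LinearMap.pow_mulLeft, LinearMap.mulLeft_apply, Pi.mul_apply, Pi.pow_apply,
      ← zpow_natCast, ← zpow_mul, neg_mul, mul_comm m, rootOfUnity_zpow_neg_mul, one_mul]
    rfl
  | y_gam =>
    change rootOfUnity n ^ (-(m - 1)) * φ (m - 1) =
      rootOfUnity n * (rootOfUnity n ^ (-m) * φ (m - 1))
    rw [hω (m - 1), sub_add_cancel, mul_assoc]
  | gam_del =>
    change rootOfUnity n ^ (-m) * ((m + 1) * φ (m + 1)) =
      rootOfUnity n * ((m + 1) * (rootOfUnity n ^ (-(m + 1)) * φ (m + 1)))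
    rw [hω m]
    ring

/-- The representation of the crossed product on formal series in `y`. It separates the operators
which occur in the bimodules. -/
noncomputable def seriesRep : CrossedProduct n →ₐ[ℂ] Module.End ℂ (ℤ → ℂ) :=
  RingQuot.liftAlgHom ℂ ⟨FreeAlgebra.lift ℂ (seriesGen n), lift_seriesGen_eq_of_rel n⟩

lemma seriesRep_gen (g : Gen) : seriesRep n (gen n g) = seriesGen n g := by
  change RingQuot.liftAlgHom ℂ _ (RingQuot.mkAlgHom ℂ (Rel n) _) = _
  rw [RingQuot.liftAlgHom_mkAlgHom_apply, FreeAlgebra.lift_ι_apply]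

lemma seriesRep_gam_pow (j : ℕ) (φ : ℤ → ℂ) (m : ℤ) :
    seriesRep n (gam n ^ j) φ m = (rootOfUnity n ^ (-m)) ^ j * φ m := by
  rw [map_pow, gam, seriesRep_gen, seriesGen, LinearMap.pow_mulLeft]
  rfl

lemma seriesRep_yPow (a : ℤ) (φ : ℤ → ℂ) (m : ℤ) : seriesRep n (yPow n a) φ m = φ (m - a) := by
  induction a using Int.induction_on generalizing m with
  | zero => rw [yPow_zero, map_one, Module.End.one_apply, sub_zero]
  | succ a ih =>
    have hy : yPow n 1 = gen n Gen.y := by rw [yPow, zpow_one]; rfl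
    rw [add_comm, yPow_add, map_mul, Module.End.mul_apply, hy, seriesRep_gen]
    exact (ih (m - 1)).trans (congrArg φ (sub_sub m 1 a))
  | pred a ih =>
    have hy : yPow n (-1) = gen n Gen.yinv := by rw [yPow, zpow_neg_one]; rfl
    rw [sub_eq_neg_add, yPow_add, map_mul, Module.End.mul_apply, hy, seriesRep_gen]
    exact (ih (m + 1)).trans (congrArg φ (by ring))

lemma seriesRep_del (φ : ℤ → ℂ) (m : ℤ) : seriesRep n (del n) φ m = (m + 1) * φ (m + 1) := by
  rw [del, seriesRep_gen]
  rfl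

lemma seriesRep_del_pow (i : ℕ) (φ : ℤ → ℂ) (m : ℤ) :
    seriesRep n (del n ^ i) φ m = (descPochhammer ℂ i).eval ((m : ℂ) + i) * φ (m + i) := by
  induction i generalizing m with
  | zero => simp
  | succ i ih =>
    rw [pow_succ', map_mul, Module.End.mul_apply, seriesRep_del, ih, descPochhammer_succ_eval,
      add_assoc m, add_comm 1 (i : ℤ)]
    push_cast
    ring_nf

lemma seriesRep_scaledEuler :
    seriesRep n (scaledEuler n) = Algebra.lmul ℂ (ℤ → ℂ) fun m : ℤ => (m : ℂ) / n := by
  refine LinearMap.ext fun φ => funext fun m => ?_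
  rw [scaledEuler, euler, map_smul, map_mul, LinearMap.smul_apply, Pi.smul_apply,
    Module.End.mul_apply, seriesRep_yPow, seriesRep_del, sub_add_cancel, smul_eq_mul]
  change _ = (m : ℂ) / n * φ m
  push_cast
  ring

lemma seriesRep_aeval (f : ℂ[X]) (φ : ℤ → ℂ) (m : ℤ) :
    seriesRep n (aeval (scaledEuler n) f) φ m = f.eval ((m : ℂ) / n) * φ m := by
  rw [← aeval_algHom_apply, seriesRep_scaledEuler, aeval_algHom_apply, aeval_pi_apply]
  simp only [coe_aeval_eq_eval]
  rfl

lemma seriesRep_idem_zero_single (t : ℤ) :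
    seriesRep n (idem n 0) (Pi.single (n * t) 1) = Pi.single (n * t) 1 := by
  have hgam (j : ℕ) : seriesRep n (gam n ^ j) (Pi.single (n * t) 1) = Pi.single (n * t) 1 := by
    ext m
    rw [seriesRep_gam_pow]
    rcases eq_or_ne m (n * t) with rfl | hm
    · rw [rootOfUnity_zpow_neg_mul, one_pow, one_mul]
    · rw [Pi.single_eq_of_ne hm, mul_zero]
  simp only [idem, map_smul, map_sum, LinearMap.smul_apply, LinearMap.sum_apply, pow_zero,
    one_smul, hgam, Finset.sum_const, Finset.card_range]
  rw [← Nat.cast_smul_eq_nsmul ℂ, inv_smul_smul₀ (NeZero.ne _)]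

/-- The coefficient of `y ^ (n t - n a)` in the image of `y ^ (n t)`. -/
noncomputable def seriesCoeff (a t : ℤ) : CrossedProduct n →ₗ[ℂ] ℂ :=
  LinearMap.proj (n * t + n * -a) ∘ₗ LinearMap.applyₗ (Pi.single (n * t) 1 : ℤ → ℂ) ∘ₗ
    (seriesRep n).toLinearMap

lemma seriesCoeff_apply (a t : ℤ) (x : CrossedProduct n) :
    seriesCoeff n a t x = seriesRep n x (Pi.single (n * t) 1) (n * t + n * -a) := rfl

lemma seriesCoeff_mono (a b t : ℤ) (f : ℂ[X]) :
    seriesCoeff n a t (mono n (n * -b) f) = if a = b then f.eval (t : ℂ) else 0 := by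
  rw [seriesCoeff_apply, mono_apply, map_mul, map_mul, Module.End.mul_apply, Module.End.mul_apply,
    seriesRep_yPow, seriesRep_aeval, seriesRep_idem_zero_single]
  split_ifs with h
  · simp [h, NeZero.ne (n : ℂ)]
  · rw [Pi.single_eq_of_ne, mul_zero]
    refine fun hc => h (mul_left_cancel₀ (NeZero.ne (n : ℤ)) ?_)
    linarith

lemma seriesCoeff_yPow_mul_gam_pow_mul_del_pow (a t b : ℤ) (j i : ℕ) :
    seriesCoeff n a t (yPow n b * gam n ^ j * del n ^ i) =
      if b - i = n * -a then
        (rootOfUnity n ^ i) ^ j * (descPochhammer ℂ i).eval (n * t : ℂ) else 0 := by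
  rw [seriesCoeff_apply, map_mul, map_mul, Module.End.mul_apply, Module.End.mul_apply,
    seriesRep_yPow, seriesRep_gam_pow, seriesRep_del_pow]
  split_ifs with h
  · obtain rfl : b = n * -a + i := by linarith
    have hω : rootOfUnity n ^ (-((n : ℤ) * t + -i)) = rootOfUnity n ^ i := by
      rw [neg_add, neg_neg, zpow_add₀ (rootOfUnity_ne_zero n), rootOfUnity_zpow_neg_mul, one_mul,
        zpow_natCast]
    rw [add_comm (n * t : ℤ), add_sub_add_left_eq_sub, sub_eq_add_neg, hω, neg_add_cancel_right,
      Pi.single_eq_same]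
    push_cast
    rw [neg_add_cancel_right, mul_one]
  · rw [Pi.single_eq_of_ne (by omega), mul_zero, mul_zero]

end Representation

section OrderFiltration

open Polynomial

variable (n : ℕ)

lemma yPow_mul_gam_pow_mul_del_pow_mem_orderLT {N i : ℕ} (h : i < N) (a : ℤ) (j : ℕ) :
    yPow n a * gam n ^ j * del n ^ i ∈ orderLT n N :=
  Submodule.subset_span ⟨a, j, i, h, rfl⟩

lemma yPow_mul_del_pow_mem_orderLT {N i : ℕ} (h : i < N) (a : ℤ) :
    yPow n a * del n ^ i ∈ orderLT n N := by
  simpa using yPow_mul_gam_pow_mul_del_pow_mem_orderLT n h a 0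

lemma orderLT_mono : Monotone (orderLT n) := fun N N' h => by
  refine Submodule.span_mono ?_
  rintro _ ⟨a, j, i, hi, rfl⟩
  exact ⟨a, j, i, hi.trans_le h, rfl⟩

variable {n}

lemma mul_mem_orderLT {x s : CrossedProduct n} {N N' : ℕ}
    (h : ∀ a j i, i < N → x * (yPow n a * gam n ^ j * del n ^ i) ∈ orderLT n N')
    (hs : s ∈ orderLT n N) : x * s ∈ orderLT n N' := by
  have hle : orderLT n N ≤ (orderLT n N').comap (LinearMap.mulLeft ℂ x) := by
    refine Submodule.span_le.mpr ?_
    rintro _ ⟨a, j, i, hi, rfl⟩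
    exact h a j i hi
  exact hle hs

lemma yPow_mul_mem_orderLT (b : ℤ) {N : ℕ} {s : CrossedProduct n} (hs : s ∈ orderLT n N) :
    yPow n b * s ∈ orderLT n N := by
  refine mul_mem_orderLT (fun a j i hi => ?_) hs
  rw [← mul_assoc, ← mul_assoc, ← yPow_add]
  exact yPow_mul_gam_pow_mul_del_pow_mem_orderLT n hi _ _

lemma gam_mul_mem_orderLT {N : ℕ} {s : CrossedProduct n} (hs : s ∈ orderLT n N) :
    gam n * s ∈ orderLT n N := by
  refine mul_mem_orderLT (fun a j i hi => ?_) hs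
  rw [← mul_assoc, ← mul_assoc, gam_mul_yPow, smul_mul_assoc, smul_mul_assoc, mul_assoc (yPow n a),
    ← pow_succ']
  exact Submodule.smul_mem _ _ (yPow_mul_gam_pow_mul_del_pow_mem_orderLT n hi _ _)

lemma gam_pow_mul_mem_orderLT (j : ℕ) {N : ℕ} {s : CrossedProduct n} (hs : s ∈ orderLT n N) :
    gam n ^ j * s ∈ orderLT n N := by
  induction j with
  | zero => rwa [pow_zero, one_mul]
  | succ j ih =>
    rw [pow_succ', mul_assoc]
    exact gam_mul_mem_orderLT ih

lemma idem_mul_mem_orderLT (i : ℕ) {N : ℕ} {s : CrossedProduct n} (hs : s ∈ orderLT n N) :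
    idem n i * s ∈ orderLT n N := by
  rw [idem, smul_mul_assoc, Finset.sum_mul]
  refine Submodule.smul_mem _ _ (sum_mem fun j _ => ?_)
  rw [_root_.smul_pow, smul_mul_assoc]
  exact Submodule.smul_mem _ _ (gam_pow_mul_mem_orderLT j hs)

lemma euler_mul_yPow_mul (a : ℤ) (x : CrossedProduct n) :
    euler n * (yPow n a * x) = yPow n a * (euler n * x) + (a : ℂ) • (yPow n a * x) := by
  rw [← mul_assoc, euler_mul_yPow, mul_assoc, add_mul, mul_add, smul_mul_assoc, one_mul,
    mul_smul_comm]

lemma euler_mul_mem_orderLT {N : ℕ} {s : CrossedProduct n} (hs : s ∈ orderLT n N) :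
    euler n * s ∈ orderLT n (N + 1) := by
  refine mul_mem_orderLT (fun a j i hi => ?_) hs
  rw [mul_assoc, euler_mul_yPow_mul, ← mul_assoc _ _ (del n ^ i),
    ← ((commute_gam_euler n).pow_left j).eq, mul_assoc (gam n ^ j), euler, mul_assoc (yPow n 1),
    ← pow_succ', ← mul_assoc]
  refine add_mem ?_ (Submodule.smul_mem _ _ ?_)
  · rw [mul_assoc]
    exact yPow_mul_mem_orderLT a (gam_pow_mul_mem_orderLT j
      (yPow_mul_del_pow_mem_orderLT n (Nat.succ_lt_succ hi) 1))
  · exact yPow_mul_mem_orderLT a (gam_pow_mul_mem_orderLT j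
      (by simpa [yPow_zero] using yPow_mul_del_pow_mem_orderLT n (Nat.lt_succ_of_lt hi) 0))

lemma euler_pow_sub_mem_orderLT (N : ℕ) :
    euler n ^ N - yPow n N * del n ^ N ∈ orderLT n N := by
  induction N with
  | zero => simp [yPow_zero]
  | succ N ih =>
    have h : euler n ^ (N + 1) - yPow n (N + 1 : ℕ) * del n ^ (N + 1) =
        euler n * (euler n ^ N - yPow n N * del n ^ N) +
          (N : ℂ) • (yPow n N * del n ^ N) := by
      rw [mul_sub, ← pow_succ', euler_mul_yPow_mul]
      nth_rw 3 [euler]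
      rw [mul_assoc (yPow n 1), ← pow_succ', ← mul_assoc, ← yPow_add, Int.cast_natCast,
        Nat.cast_succ, sub_add_eq_sub_sub, sub_add_cancel]
    rw [h]
    exact add_mem (euler_mul_mem_orderLT ih)
      (Submodule.smul_mem _ _ (yPow_mul_del_pow_mem_orderLT n N.lt_succ_self N))

lemma scaledEuler_pow_sub_mem_orderLT (N : ℕ) :
    scaledEuler n ^ N - ((n : ℂ)⁻¹ ^ N) • (yPow n N * del n ^ N) ∈ orderLT n N := by
  rw [scaledEuler, _root_.smul_pow, ← smul_sub]
  exact Submodule.smul_mem _ _ (euler_pow_sub_mem_orderLT N)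

lemma scaledEuler_pow_mem_orderLT {N i : ℕ} (h : i < N) : scaledEuler n ^ i ∈ orderLT n N := by
  rw [← sub_add_cancel (scaledEuler n ^ i) ((n : ℂ)⁻¹ ^ i • (yPow n i * del n ^ i))]
  exact add_mem (orderLT_mono n h.le (scaledEuler_pow_sub_mem_orderLT i))
    (Submodule.smul_mem _ _ (yPow_mul_del_pow_mem_orderLT n h i))

lemma aeval_scaledEuler_mem_orderLT {N : ℕ} {f : ℂ[X]} (hf : f.degree < N) :
    aeval (scaledEuler n) f ∈ orderLT n N := by
  rw [aeval_eq_sum_range]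
  refine sum_mem fun i _ => ?_
  by_cases hi : f.coeff i = 0
  · simp [hi]
  · exact Submodule.smul_mem _ _ (scaledEuler_pow_mem_orderLT
      (Nat.cast_lt.mp ((le_degree_of_ne_zero hi).trans_lt hf)))

lemma aeval_scaledEuler_sub_mem_orderLT {N : ℕ} {f : ℂ[X]} (hf : f.natDegree ≤ N) :
    aeval (scaledEuler n) f - (f.coeff N * (n : ℂ)⁻¹ ^ N) • (yPow n N * del n ^ N) ∈
      orderLT n N := by
  rw [aeval_eq_sum_range' (Nat.lt_succ_of_le hf), Finset.sum_range_succ, add_sub_assoc, mul_smul,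
    ← smul_sub]
  exact add_mem (sum_mem fun i hi => Submodule.smul_mem _ _
    (scaledEuler_pow_mem_orderLT (Finset.mem_range.mp hi)))
    (Submodule.smul_mem _ _ (scaledEuler_pow_sub_mem_orderLT N))

end OrderFiltration

section OperatorSums

open Polynomial

variable (n : ℕ)

/-- The operator `∑ y ^ (-n a) φ_a(y ∂ / n) e`. -/
noncomputable def opSum : (ℤ →₀ ℂ[X]) →ₗ[ℂ] CrossedProduct n :=
  Finsupp.lsum ℂ fun a => mono n (n * -a)

lemma opSum_single (a : ℤ) (f : ℂ[X]) : opSum n (Finsupp.single a f) = mono n (n * -a) f :=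
  Finsupp.lsum_single ..

lemma exists_opSum_eq {n : ℕ} {G : ℤ → ℂ[X]} {β : CrossedProduct n} (h : β ∈ gradedSpan n G) :
    ∃ φ, (∀ a, G a ∣ φ a) ∧ opSum n φ = β := by
  induction h using Submodule.span_induction with
  | mem x hx =>
    obtain ⟨a, f, rfl⟩ := hx
    refine ⟨Finsupp.single a (G a * f), fun b => ?_, opSum_single n a _⟩
    rcases eq_or_ne b a with rfl | hb
    · simp
    · simp [Finsupp.single_eq_of_ne hb]
  | zero => exact ⟨0, by simp, map_zero _⟩
  | add x y _ _ hx hy =>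
    obtain ⟨φ, hφ, rfl⟩ := hx
    obtain ⟨ψ, hψ, rfl⟩ := hy
    exact ⟨φ + ψ, fun a => dvd_add (hφ a) (hψ a), map_add _ _ _⟩
  | smul c x _ hx =>
    obtain ⟨φ, hφ, rfl⟩ := hx
    exact ⟨c • φ, fun a => dvd_smul_of_dvd c (hφ a), map_smul _ _ _⟩

lemma gradedSpan_le_range_opSum (G : ℤ → ℂ[X]) : gradedSpan n G ≤ LinearMap.range (opSum n) :=
  fun _ hβ => let ⟨φ, _, h⟩ := exists_opSum_eq hβ; ⟨φ, h⟩

/-- The Laurent polynomial `f(y)` such that an operator `opSum n φ` of order at most `N` has the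
form `e f(y) ∂ ^ N` up to operators of smaller order. -/
noncomputable def leadingCoeff (N : ℕ) : (ℤ →₀ ℂ[X]) →ₗ[ℂ] (ℤ →₀ ℂ) :=
  Finsupp.lsum ℂ fun a =>
    ((n : ℂ)⁻¹ ^ N) • (Finsupp.lsingle ((N : ℤ) + n * -a) ∘ₗ lcoeff ℂ N)

lemma leadingCoeff_single (N : ℕ) (a : ℤ) (f : ℂ[X]) : leadingCoeff n N (Finsupp.single a f) =
    Finsupp.single ((N : ℤ) + n * -a) (f.coeff N * (n : ℂ)⁻¹ ^ N) := by
  rw [leadingCoeff, Finsupp.lsum_single]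
  simp [mul_comm]

lemma evalY_eq_linearCombination (f : ℤ →₀ ℂ) :
    evalY n f = Finsupp.linearCombination ℂ (yPow n) f := rfl

variable [NeZero n]

lemma commute_idem_zero_yPow (a : ℤ) : Commute (idem n 0) (yPow n (n * a)) := by
  have h : Commute (gam n) (yPow n (n * a)) := by
    rw [commute_iff_eq, gam_mul_yPow, rootOfUnity_zpow_neg_mul, one_smul]
  exact (Commute.sum_left _ _ _ fun j _ => (h.smul_left _).pow_left j).smul_left _

lemma mono_eq_idem_mul (a : ℤ) (f : ℂ[X]) :
    mono n (n * a) f = idem n 0 * (yPow n (n * a) * aeval (scaledEuler n) f) := by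
  rw [mono_apply, mul_assoc, ← (commute_idem_aeval n 0 f).eq, ← mul_assoc,
    ← (commute_idem_zero_yPow n a).eq, mul_assoc]

lemma mono_mem_orderLT {N : ℕ} (a : ℤ) {f : ℂ[X]} (hf : f.degree < N) :
    mono n (n * a) f ∈ orderLT n N := by
  rw [mono_eq_idem_mul]
  exact idem_mul_mem_orderLT 0 (yPow_mul_mem_orderLT _ (aeval_scaledEuler_mem_orderLT hf))

lemma mono_sub_mem_orderLT {N : ℕ} (a : ℤ) {f : ℂ[X]} (hf : f.natDegree ≤ N) :
    mono n (n * a) f - (f.coeff N * (n : ℂ)⁻¹ ^ N) • (idem n 0 * yPow n (N + n * a) * del n ^ N) ∈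
      orderLT n N := by
  have h := idem_mul_mem_orderLT 0
    (yPow_mul_mem_orderLT (n * a) (aeval_scaledEuler_sub_mem_orderLT (n := n) hf))
  rwa [mul_sub, mul_sub, ← mono_eq_idem_mul, mul_smul_comm, mul_smul_comm, ← mul_assoc (yPow n _),
    ← yPow_add, add_comm _ (N : ℤ), ← mul_assoc] at h

lemma opSum_sub_mem_orderLT {N : ℕ} {φ : ℤ →₀ ℂ[X]} (h : ∀ a, (φ a).natDegree ≤ N) :
    opSum n φ - idem n 0 * evalY n (leadingCoeff n N φ) * del n ^ N ∈ orderLT n N := by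
  rw [← φ.sum_single, Finsupp.sum, evalY_eq_linearCombination, map_sum, map_sum, map_sum,
    Finset.mul_sum, Finset.sum_mul, ← Finset.sum_sub_distrib]
  refine sum_mem fun a _ => ?_
  rw [opSum_single, leadingCoeff_single, Finsupp.linearCombination_single, mul_smul_comm,
    smul_mul_assoc]
  exact mono_sub_mem_orderLT n (-a) (h a)

lemma seriesCoeff_opSum (φ : ℤ →₀ ℂ[X]) (a t : ℤ) :
    seriesCoeff n a t (opSum n φ) = (φ a).eval (t : ℂ) := by
  induction φ using Finsupp.induction_linear with
  | zero => simp
  | add φ ψ hφ hψ => simp [hφ, hψ]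
  | single b f =>
    rw [opSum_single, seriesCoeff_mono, Finsupp.single_apply]
    simp only [eq_comm (a := a)]
    split_ifs <;> simp

lemma exists_seriesCoeff_eq_eval {N : ℕ} {x : CrossedProduct n} (hx : x ∈ orderLT n N) (a : ℤ) :
    ∃ P : ℂ[X], P.degree < N ∧ ∀ t : ℤ, seriesCoeff n a t x = P.eval (t : ℂ) := by
  induction hx using Submodule.span_induction with
  | mem x hx =>
    obtain ⟨b, j, i, hi, rfl⟩ := hx
    let P : ℂ[X] := C ((rootOfUnity n ^ i) ^ j) * (descPochhammer ℂ i).comp (C (n : ℂ) * X)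
    have hP : P.natDegree ≤ i := by
      refine (natDegree_C_mul_le _ _).trans (natDegree_comp_le.trans ?_)
      rw [descPochhammer_natDegree]
      exact mul_le_of_le_one_right' ((natDegree_C_mul_le _ _).trans natDegree_X_le)
    refine ⟨if b - i = n * -a then P else 0, ?_, fun t => ?_⟩
    · split_ifs
      · exact degree_le_natDegree.trans_lt (mod_cast hP.trans_lt hi)
      · simp
    · rw [seriesCoeff_yPow_mul_gam_pow_mul_del_pow]
      split_ifs <;> simp [P]
  | zero => exact ⟨0, by simp, by simp⟩
  | add x y _ _ hx hy =>
    obtain ⟨P, hP, hPx⟩ := hx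
    obtain ⟨Q, hQ, hQy⟩ := hy
    exact ⟨P + Q, (degree_add_le _ _).trans_lt (max_lt hP hQ), fun t => by simp [hPx, hQy]⟩
  | smul c x _ hx =>
    obtain ⟨P, hP, hPx⟩ := hx
    exact ⟨c • P, (degree_smul_le _ _).trans_lt hP, fun t => by simp [hPx]⟩

lemma eq_of_eval_intCast_eq {R : Type*} [CommRing R] [IsDomain R] [CharZero R] {P Q : R[X]}
    (h : ∀ t : ℤ, P.eval (t : R) = Q.eval (t : R)) : P = Q :=
  eq_of_infinite_eval_eq P Q ((Set.infinite_range_of_injective Int.cast_injective).mono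
    (Set.range_subset_iff.mpr h))

variable {n}

theorem opSum_mem_orderLT_iff {N : ℕ} {φ : ℤ →₀ ℂ[X]} :
    opSum n φ ∈ orderLT n N ↔ ∀ a, (φ a).degree < N := by
  constructor
  · intro h a
    obtain ⟨P, hP, hPφ⟩ := exists_seriesCoeff_eq_eval n h a
    rwa [eq_of_eval_intCast_eq fun t => (seriesCoeff_opSum n φ a t).symm.trans (hPφ t)]
  · intro h
    exact sum_mem fun a _ => mono_mem_orderLT n (-a) (h a)

variable (n) in
lemma opSum_injective : Function.Injective (opSum n) := by
  intro φ ψ h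
  ext1 a
  refine eq_of_eval_intCast_eq fun t => ?_
  rw [← seriesCoeff_opSum n, h, seriesCoeff_opSum]

end OperatorSums

section SymbolMap

open Polynomial

variable (n : ℕ)

/-- The symbol of order `N` of the operator `opSum n φ`, in the coordinates `x = u v` and
`z = v ^ n`. -/
noncomputable def symb (N : ℕ) : (ℤ →₀ ℂ[X]) →ₗ[ℂ] TorusRing :=
  Finsupp.lsum ℂ fun a =>
    ((n : ℂ)⁻¹ ^ N) • (AddMonoidAlgebra.lsingle ((N : ℤ) + n * -a, a) ∘ₗ lcoeff ℂ N)

lemma symb_single (N : ℕ) (a : ℤ) (f : ℂ[X]) : symb n N (Finsupp.single a f) =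
    AddMonoidAlgebra.single ((N : ℤ) + n * -a, a) (f.coeff N * (n : ℂ)⁻¹ ^ N) := by
  rw [symb, Finsupp.lsum_single]
  simp [mul_comm]

lemma coeff_symb (N : ℕ) (φ : ℤ →₀ ℂ[X]) (m : ℤ × ℤ) : (symb n N φ).coeff m =
    if m.1 + n * m.2 = N then (φ m.2).coeff N * (n : ℂ)⁻¹ ^ N else 0 := by
  induction φ using Finsupp.induction_linear with
  | zero => simp
  | add φ ψ hφ hψ =>
    rw [map_add, AddMonoidAlgebra.coeff_add, Finsupp.add_apply, hφ, hψ]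
    split_ifs <;> simp [add_mul]
  | single a f =>
    obtain ⟨m₁, m₂⟩ := m
    rw [symb_single, AddMonoidAlgebra.coeff_single, Finsupp.single_apply]
    rcases eq_or_ne a m₂ with rfl | ha
    · have h : (N : ℤ) + n * -a = m₁ ↔ m₁ + n * a = N := by constructor <;> intro h <;> linarith
      simp only [Prod.mk.injEq, h, and_true, Finsupp.single_eq_same]
    · simp [ha, Finsupp.single_eq_of_ne ha.symm]

lemma symbol_eq_linearCombination (f : ℤ →₀ ℂ) (N : ℕ) : symbol f N =
    Finsupp.linearCombination ℂ (fun a => AddMonoidAlgebra.single (a, (N : ℤ)) (1 : ℂ)) f := by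
  simp [symbol, Finsupp.linearCombination_apply]

lemma toSymbol_symb (N : ℕ) (φ : ℤ →₀ ℂ[X]) :
    toSymbol n (symb n N φ) = symbol (leadingCoeff n N φ) N := by
  rw [symbol_eq_linearCombination]
  induction φ using Finsupp.induction_linear with
  | zero => simp
  | add φ ψ hφ hψ => simp only [map_add, hφ, hψ]
  | single a f =>
    rw [symb_single, leadingCoeff_single, Finsupp.linearCombination_single]
    simp [toSymbol]

variable [NeZero n]

lemma symb_eq_zero_iff {N : ℕ} {φ : ℤ →₀ ℂ[X]} (hφ : ∀ a, (φ a).natDegree ≤ N) :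
    symb n N φ = 0 ↔ opSum n φ ∈ orderLT n N := by
  rw [opSum_mem_orderLT_iff]
  constructor
  · intro h a
    refine (natDegree_le_iff_degree_le.mp (hφ a)).lt_of_ne fun hdeg => ?_
    have ha := coeff_symb n N φ ((N : ℤ) + n * -a, a)
    rw [h, if_pos (by ring)] at ha
    exact coeff_ne_zero_of_eq_degree hdeg (by simpa [NeZero.ne (n : ℂ)] using ha.symm)
  · intro h
    ext m
    rw [coeff_symb, coeff_eq_zero_of_degree_lt (h m.2)]
    simp

variable {n} {B : Submodule ℂ (CrossedProduct n)} (hB : B ≤ LinearMap.range (opSum n))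

/-- The coefficients `φ` of an operator `opSum n φ` which lies in `B`. -/
noncomputable def opCoords (N : ℕ) : ↥(B ⊓ orderLE n N) →ₗ[ℂ] ℤ →₀ ℂ[X] :=
  (LinearEquiv.ofInjective (opSum n) (opSum_injective n)).symm.toLinearMap ∘ₗ
    Submodule.inclusion (inf_le_left.trans hB)

lemma opSum_opCoords (N : ℕ) (β : ↥(B ⊓ orderLE n N)) : opSum n (opCoords hB N β) = β :=
  congrArg Subtype.val ((LinearEquiv.ofInjective (opSum n) (opSum_injective n)).apply_symm_apply
    (Submodule.inclusion (inf_le_left.trans hB) β))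

lemma opCoords_eq_of_opSum_eq {N : ℕ} {β : ↥(B ⊓ orderLE n N)} {φ : ℤ →₀ ℂ[X]}
    (h : opSum n φ = β) : opCoords hB N β = φ :=
  opSum_injective n ((opSum_opCoords hB N β).trans h.symm)

lemma natDegree_opCoords_le (N : ℕ) (β : ↥(B ⊓ orderLE n N)) (a : ℤ) :
    (opCoords hB N β a).natDegree ≤ N := by
  have h : opSum n (opCoords hB N β) ∈ orderLT n (N + 1) := by
    rw [opSum_opCoords]
    exact β.2.2
  exact natDegree_le_iff_coeff_eq_zero.mpr fun i hi => coeff_eq_zero_of_degree_lt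
    ((opSum_mem_orderLT_iff.mp h a).trans_le (mod_cast hi))

lemma symb_opCoords_eq_zero_iff (N : ℕ) (β : ↥(B ⊓ orderLE n N)) :
    symb n N (opCoords hB N β) = 0 ↔ (β : CrossedProduct n) ∈ orderLT n N := by
  rw [symb_eq_zero_iff n (natDegree_opCoords_le hB N β), opSum_opCoords]

/-- The symbol map on a graded piece of `gr B`. -/
noncomputable def grPieceSymb (N : ℕ) : GrPiece B N →ₗ[ℂ] TorusRing :=
  Submodule.liftQ _ (symb n N ∘ₗ opCoords hB N)
    fun β hβ => (symb_opCoords_eq_zero_iff hB N β).mpr hβ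

lemma grPieceSymb_mk (N : ℕ) (β : ↥(B ⊓ orderLE n N)) :
    grPieceSymb hB N (Submodule.Quotient.mk β) = symb n N (opCoords hB N β) := rfl

lemma grPieceSymb_injective (N : ℕ) : Function.Injective (grPieceSymb hB N) :=
  LinearMap.ker_eq_bot.mp <|
    Submodule.ker_liftQ_eq_bot _ _ _ fun β hβ => (symb_opCoords_eq_zero_iff hB N β).mp hβ

lemma coeff_grPieceSymb_of_ne {N : ℕ} (x : GrPiece B N) {m : ℤ × ℤ} (hm : m.1 + n * m.2 ≠ N) :
    (grPieceSymb hB N x).coeff m = 0 := by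
  induction x using Submodule.Quotient.induction_on with
  | H β => rw [grPieceSymb_mk, coeff_symb, if_neg hm]

/-- The symbol map on `gr B`. -/
noncomputable def grSymb : Gr B →ₗ[ℂ] TorusRing :=
  DirectSum.toModule ℂ ℕ TorusRing (grPieceSymb hB)

lemma grSymb_grClass (N : ℕ) (β : ↥(B ⊓ orderLE n N)) :
    grSymb hB (grClass B N β) = symb n N (opCoords hB N β) :=
  DirectSum.toModule_lof ℂ N _

lemma coeff_grSymb (x : Gr B) {m : ℤ × ℤ} {N : ℕ} (hm : m.1 + n * m.2 = N) :
    (grSymb hB x).coeff m = (grPieceSymb hB N (x N)).coeff m := by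
  induction x using DirectSum.induction_on with
  | zero => simp
  | of N' x =>
    have h : grSymb hB (DirectSum.of (GrPiece B) N' x) = grPieceSymb hB N' x :=
      DirectSum.toModule_lof ℂ N' x
    rw [h]
    rcases eq_or_ne N N' with rfl | hN
    · rw [DirectSum.of_eq_same]
    · rw [DirectSum.of_eq_of_ne _ _ _ hN, map_zero, coeff_grPieceSymb_of_ne hB x (by omega)]
      rfl
  | add x y hx hy =>
    rw [map_add, AddMonoidAlgebra.coeff_add, Finsupp.add_apply, hx, hy, DirectSum.add_apply,
      map_add, AddMonoidAlgebra.coeff_add, Finsupp.add_apply]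

lemma grSymb_injective : Function.Injective (grSymb hB) := by
  intro x y h
  -- The order `m₁ + n m₂` of `x ^ m₁ z ^ m₂` separates the graded pieces.
  ext1 N
  apply grPieceSymb_injective hB N
  ext m
  by_cases hm : m.1 + n * m.2 = N
  · rw [← coeff_grSymb hB x hm, ← coeff_grSymb hB y hm, h]
  · rw [coeff_grPieceSymb_of_ne hB _ hm, coeff_grPieceSymb_of_ne hB _ hm]

section GradedSpan

variable {G : ℤ → ℂ[X]}

lemma dvd_opCoords (N : ℕ) (β : ↥(gradedSpan n G ⊓ orderLE n N)) (a : ℤ) :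
    G a ∣ opCoords (gradedSpan_le_range_opSum n G) N β a := by
  obtain ⟨φ, hφ, h⟩ := exists_opSum_eq β.2.1
  rw [opCoords_eq_of_opSum_eq _ h]
  exact hφ a

lemma natDegree_le_of_coeff_symb_opCoords_ne_zero {N : ℕ}
    (β : ↥(gradedSpan n G ⊓ orderLE n N)) {m : ℤ × ℤ}
    (hm : (symb n N (opCoords (gradedSpan_le_range_opSum n G) N β)).coeff m ≠ 0) :
    ((G m.2).natDegree : ℤ) ≤ m.1 + n * m.2 := by
  rw [coeff_symb, ite_ne_right_iff] at hm
  have hne : opCoords (gradedSpan_le_range_opSum n G) N β m.2 ≠ 0 := fun h =>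
    hm.2 (by rw [h, coeff_zero, zero_mul])
  have hle := (natDegree_le_of_dvd (dvd_opCoords N β m.2) hne).trans
    (natDegree_opCoords_le (gradedSpan_le_range_opSum n G) N β m.2)
  omega

lemma natDegree_le_of_coeff_grSymb_ne_zero (x : Gr (gradedSpan n G)) {m : ℤ × ℤ}
    (hm : (grSymb (gradedSpan_le_range_opSum n G) x).coeff m ≠ 0) :
    ((G m.2).natDegree : ℤ) ≤ m.1 + n * m.2 := by
  induction x using DirectSum.induction_on with
  | zero => simp at hm
  | of N x =>
    induction x using Submodule.Quotient.induction_on with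
    | H β =>
      change (grSymb _ (grClass _ N β)).coeff m ≠ 0 at hm
      rw [grSymb_grClass] at hm
      exact natDegree_le_of_coeff_symb_opCoords_ne_zero β hm
  | add x y hx hy =>
    rw [map_add, AddMonoidAlgebra.coeff_add, Finsupp.add_apply] at hm
    by_cases h : (grSymb (gradedSpan_le_range_opSum n G) x).coeff m = 0
    · exact hy (by rwa [h, zero_add] at hm)
    · exact hx h

lemma symb_mem_range_grSymb {N : ℕ} {φ : ℤ →₀ ℂ[X]} (hφ : ∀ a, (φ a).natDegree ≤ N)
    (hB' : opSum n φ ∈ B) : symb n N φ ∈ LinearMap.range (grSymb hB) := by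
  have h : opSum n φ ∈ orderLE n N := opSum_mem_orderLT_iff.mpr fun a =>
    degree_le_natDegree.trans_lt (mod_cast Nat.lt_succ_of_le (hφ a))
  exact ⟨grClass B N ⟨_, hB', h⟩, by rw [grSymb_grClass, opCoords_eq_of_opSum_eq hB rfl]⟩

lemma single_mem_range_grSymb (hG : ∀ a, (G a).Monic) {m : ℤ × ℤ}
    (hm : ((G m.2).natDegree : ℤ) ≤ m.1 + n * m.2) (c : ℂ) :
    AddMonoidAlgebra.single m c ∈ LinearMap.range (grSymb (gradedSpan_le_range_opSum n G)) := by
  obtain ⟨m₁, a⟩ := m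
  obtain ⟨d, rfl⟩ : ∃ d : ℕ, m₁ = (((G a).natDegree + d : ℕ) : ℤ) + n * -a :=
    ⟨(m₁ + n * a - (G a).natDegree).toNat, by
      rw [Nat.cast_add, Int.toNat_of_nonneg (sub_nonneg.mpr hm)]
      ring⟩
  set N := (G a).natDegree + d
  let f : ℂ[X] := G a * (C (c * (n : ℂ) ^ N) * X ^ d)
  have hf : f.natDegree ≤ N :=
    natDegree_mul_le.trans (Nat.add_le_add_left (natDegree_C_mul_X_pow_le _ _) _)
  have hfN : f.coeff N = c * (n : ℂ) ^ N := by
    rw [coeff_mul_add_eq_of_natDegree_le le_rfl (natDegree_C_mul_X_pow_le _ _),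
      (hG a).coeff_natDegree, coeff_C_mul_X_pow, if_pos rfl, one_mul]
  have hsymb : symb n N (Finsupp.single a f) = AddMonoidAlgebra.single (N + n * -a, a) c := by
    rw [symb_single, hfN, mul_assoc, ← mul_pow, mul_inv_cancel₀ (NeZero.ne _), one_pow, mul_one]
  rw [← hsymb]
  refine symb_mem_range_grSymb _ (fun b => ?_) ?_
  · rw [Finsupp.single_apply]
    split_ifs <;> simp [hf]
  · rw [opSum_single]
    exact mono_mem_gradedSpan (dvd_mul_right _ _)

theorem range_grSymb (hG : ∀ a, (G a).Monic) :
    Set.range (grSymb (gradedSpan_le_range_opSum n G)) =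
      {q | ∀ m, q.coeff m ≠ 0 → ((G m.2).natDegree : ℤ) ≤ m.1 + n * m.2} := by
  ext q
  constructor
  · rintro ⟨x, rfl⟩ m hm
    exact natDegree_le_of_coeff_grSymb_ne_zero x hm
  · intro hq
    rw [← LinearMap.coe_range, SetLike.mem_coe, ← AddMonoidAlgebra.sum_coeff_single q]
    exact Submodule.sum_mem _ fun m hm =>
      single_mem_range_grSymb hG (hq m (Finsupp.mem_support_iff.mp hm)) _

end GradedSpan

end SymbolMap

section Lattice

variable {n : ℕ}

/-- The sum `b_{i+1} + ⋯ + b_{n-1}`, where `b_{p+1}` is the entry `b p`. It is the entry of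
`n⁻¹ F(b)` at `i`, and the multiplicity at `i` of the roots for a chain with sum `F(b)`. -/
def latticeMult (b : Fin (n - 1) → ℕ) (i : ℕ) : ℕ :=
  ∑ p : Fin (n - 1), if i ≤ (p : ℕ) then b p else 0

lemma latticeMult_antitone (b : Fin (n - 1) → ℕ) : Antitone (latticeMult b) := by
  intro i j hij
  refine Finset.sum_le_sum fun p _ => ?_
  split_ifs <;> omega

lemma latticeMult_of_le (b : Fin (n - 1) → ℕ) {i : ℕ} (h : n - 1 ≤ i) : latticeMult b i = 0 :=
  Finset.sum_eq_zero fun p _ => if_neg (by omega)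

lemma latticeF_apply (b : Fin (n - 1) → ℕ) (q : Fin (n - 1)) :
    latticeF b q = n * (latticeMult b q : ℂ) := by
  rw [latticeF, Finset.sum_apply, latticeMult, Nat.cast_sum, Finset.mul_sum]
  refine Finset.sum_congr rfl fun p _ => ?_
  simp only [Pi.smul_apply, wVec, Fin.le_def]
  split_ifs <;> simp [mul_comm]

lemma sum_wVec_apply (l : List (Fin (n - 1))) (q : Fin (n - 1)) :
    (l.map wVec).sum q = n * (l.countP (fun p : Fin (n - 1) => (q : ℕ) ≤ p) : ℂ) := by
  induction l with
  | nil => simp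
  | cons p l ih =>
    rw [List.map_cons, List.sum_cons, Pi.add_apply, ih, List.countP_cons]
    simp only [wVec, Fin.le_def, decide_eq_true_eq]
    split_ifs <;> push_cast <;> ring

lemma listMult_eq_latticeMult [NeZero n] {l : List (Fin (n - 1))} {b : Fin (n - 1) → ℕ}
    (h : (l.map wVec).sum = latticeF b) (i : Fin n) : listMult l i = latticeMult b i := by
  by_cases hi : (i : ℕ) < n - 1
  · have hq := congrFun h ⟨i, hi⟩
    rw [sum_wVec_apply, latticeF_apply] at hq
    exact_mod_cast mul_left_cancel₀ (NeZero.ne (n : ℂ)) hq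
  · rw [latticeMult_of_le b (by omega), listMult, List.countP_eq_zero]
    intro p _
    simp only [decide_eq_true_eq]
    omega

lemma rootParam_add_latticeF [NeZero n] (k : Fin (n - 1) → ℂ) (c : Fin (n - 1) → ℕ) (i : Fin n) :
    rootParam (k + latticeF c) i = rootParam k i + latticeMult c i := by
  apply mul_left_cancel₀ (NeZero.ne (n : ℂ))
  rw [mul_add, mul_rootParam, mul_rootParam]
  by_cases h : (i : ℕ) < n - 1
  · rw [dif_pos h, dif_pos h, Pi.add_apply, latticeF_apply, add_assoc]
  · rw [dif_neg h, dif_neg h, latticeMult_of_le c (by omega), Nat.cast_zero, mul_zero, add_zero,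
      add_zero]

lemma dominantParam_add_latticeF [NeZero n] {k : Fin (n - 1) → ℂ} (hk : IsDominant k)
    (c : Fin (n - 1) → ℕ) : DominantParam (rootParam (k + latticeF c)) := by
  rw [funext (rootParam_add_latticeF k c)]
  exact (dominantParam_rootParam hk).add fun i j hij => latticeMult_antitone c hij

lemma sum_range_latticeMult (b : Fin (n - 1) → ℕ) (s : ℕ) :
    ∑ i ∈ Finset.range s, latticeMult b i = ∑ p, b p * min ((p : ℕ) + 1) s := by
  simp only [latticeMult]
  rw [Finset.sum_comm]
  refine Finset.sum_congr rfl fun p _ => ?_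
  rw [← Finset.sum_filter, Finset.sum_const, smul_eq_mul, mul_comm]
  congr 1
  have h : (Finset.range s).filter (· ≤ (p : ℕ)) = Finset.range (min (p + 1) s) := by
    ext i
    simp only [Finset.mem_filter, Finset.mem_range]
    omega
  rw [h, Finset.card_range]

lemma weight_sub_divisorCoeff (b : Fin (n - 1) → ℕ) (j : Fin (n + 1)) :
    (weight b : ℤ) - divisorCoeff b j = ∑ i ∈ Finset.range (n - j), (latticeMult b i : ℤ) := by
  rw [← Nat.cast_sum, sum_range_latticeMult, weight, divisorCoeff, Nat.cast_sum, Nat.cast_sum,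
    ← Finset.sum_sub_distrib]
  refine Finset.sum_congr rfl fun p _ => ?_
  rw [mul_comm ((p : ℕ) + 1), Nat.cast_mul, ← mul_sub, Nat.cast_mul]
  congr 1
  omega

end Lattice

section TruncatedSums

variable {M : Type*} [AddCommMonoid M] [LinearOrder M] {f : ℕ → M}

lemma exists_sum_max_zero_eq (hf : Antitone f) (n : ℕ) :
    ∃ s ≤ n, ∑ i ∈ Finset.range n, max 0 (f i) = ∑ i ∈ Finset.range s, f i := by
  induction n with
  | zero => exact ⟨0, le_rfl, rfl⟩
  | succ n ih =>
    rcases le_total (f n) 0 with h | h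
    · obtain ⟨s, hs, hsum⟩ := ih
      exact ⟨s, by omega, by rw [Finset.sum_range_succ, hsum, max_eq_left h, add_zero]⟩
    · refine ⟨n + 1, le_rfl, Finset.sum_congr rfl fun i hi => max_eq_right (h.trans (hf ?_))⟩
      exact Nat.lt_succ_iff.mp (Finset.mem_range.mp hi)

lemma sum_max_zero_le_iff [IsOrderedAddMonoid M] (hf : Antitone f) (n : ℕ) (x : M) :
    ∑ i ∈ Finset.range n, max 0 (f i) ≤ x ↔ ∀ s ≤ n, ∑ i ∈ Finset.range s, f i ≤ x := by
  constructor
  · intro h s hs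
    calc ∑ i ∈ Finset.range s, f i ≤ ∑ i ∈ Finset.range s, max 0 (f i) :=
          Finset.sum_le_sum fun i _ => le_max_right 0 (f i)
      _ ≤ ∑ i ∈ Finset.range n, max 0 (f i) :=
          Finset.sum_le_sum_of_subset_of_nonneg (Finset.range_mono hs) fun _ _ _ => le_max_left _ _
      _ ≤ x := h
  · intro h
    obtain ⟨s, hs, hsum⟩ := exists_sum_max_zero_eq hf n
    exact hsum ▸ h s hs

end TruncatedSums

section Degrees

open Polynomial

lemma monic_shiftProd {R : Type*} [CommRing R] (α : R) (s t : ℤ) : (shiftProd α s t).Monic :=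
  monic_prod_of_monic _ _ fun _ _ => monic_X_sub_C _

lemma natDegree_shiftProd {R : Type*} [CommRing R] [Nontrivial R] (α : R) (s t : ℤ) :
    (shiftProd α s t).natDegree = (t - s).toNat := by
  rw [shiftProd, natDegree_prod_of_monic _ _ fun _ _ => monic_X_sub_C _]
  simp only [natDegree_X_sub_C, Finset.sum_const, Int.card_Ico, smul_eq_mul, mul_one]

variable {ι R : Type*} [Fintype ι] [CommRing R]

lemma monic_rootProd (α : ι → R) (m : ι → ℕ) (a : ℤ) : (rootProd α m a).Monic :=
  monic_prod_of_monic _ _ fun _ _ => monic_shiftProd _ _ _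

lemma natDegree_rootProd [Nontrivial R] (α : ι → R) (m : ι → ℕ) (a : ℤ) :
    ((rootProd α m a).natDegree : ℤ) = ∑ i, max 0 (a + m i) := by
  rw [rootProd, natDegree_prod_of_monic _ _ fun _ _ => monic_shiftProd _ _ _, Nat.cast_sum]
  refine Finset.sum_congr rfl fun i _ => ?_
  rw [natDegree_shiftProd, Int.toNat_eq_max, sub_zero, max_comm]

end Degrees

section Comparison

variable {n : ℕ}

lemma forall_divisorCoeff_le_iff (b : Fin (n - 1) → ℕ) (m : ℤ × ℤ) :
    (∀ j : Fin (n + 1), -divisorCoeff b j ≤ pair (-((weight b : ℤ), 0) + m) j) ↔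
      ∑ i : Fin n, max 0 (m.2 + latticeMult b i) ≤ m.1 + n * m.2 := by
  have hanti : Antitone fun i => m.2 + (latticeMult b i : ℤ) := fun i j hij =>
    add_le_add_right (Nat.cast_le.mpr (latticeMult_antitone b hij)) _
  have hray (j : Fin (n + 1)) : -divisorCoeff b j ≤ pair (-((weight b : ℤ), 0) + m) j ↔
      ∑ i ∈ Finset.range (n - j), (m.2 + (latticeMult b i : ℤ)) ≤ m.1 + n * m.2 := by
    have hj := j.is_le
    rw [Finset.sum_add_distrib, ← weight_sub_divisorCoeff, Finset.sum_const, Finset.card_range,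
      nsmul_eq_mul, Nat.cast_sub hj, sub_mul]
    simp only [pair, Prod.fst_add, Prod.snd_add, Prod.fst_neg, Prod.snd_neg]
    constructor <;> intro h <;> linarith
  rw [Fin.sum_univ_eq_sum_range fun i => max 0 (m.2 + (latticeMult b i : ℤ)),
    sum_max_zero_le_iff hanti, forall_congr' hray]
  constructor
  · intro h s hs
    simpa [Nat.sub_sub_self hs] using h ⟨n - s, by omega⟩
  · exact fun h j => h _ (Nat.sub_le _ _)

variable [NeZero n]

variable (n) in
/-- The embedding of the coordinate ring of the torus into the function field, as a homomorphism of
algebras. -/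
noncomputable def toRationalHom : TorusRing →ₐ[ℂ] (ToricSurface n).functionField :=
  { toRational n with commutes' := fun _ => rfl }

variable {B : Submodule ℂ (CrossedProduct n)} (hB : B ≤ LinearMap.range (opSum n))

/-- The symbol map of `gr B`, divided by `x ^ w`, as a map to the function field. -/
noncomputable def grToRational (w : ℤ) : Gr B →ₗ[ℂ] (ToricSurface n).functionField :=
  (toRationalHom n).toLinearMap ∘ₗ
    LinearMap.mulLeft ℂ (AddMonoidAlgebra.single (-(w, 0)) 1) ∘ₗ grSymb hB

lemma grToRational_apply (w : ℤ) (x : Gr B) : grToRational hB w x =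
    toRational n (AddMonoidAlgebra.single (-(w, 0)) 1 * grSymb hB x) := rfl

lemma single_mul_grToRational (w : ℤ) (x : Gr B) :
    toRational n (AddMonoidAlgebra.single (w, 0) 1) * grToRational hB w x =
      toRational n (grSymb hB x) := by
  rw [grToRational_apply, ← map_mul, ← mul_assoc, AddMonoidAlgebra.single_mul_single,
    add_neg_cancel, mul_one, ← AddMonoidAlgebra.one_def, one_mul]

lemma grToRational_injective (w : ℤ) : Function.Injective (grToRational hB w) := by
  intro x y h
  apply grSymb_injective hB
  apply toRational_injective (n := n)
  rw [← single_mul_grToRational hB w, h, single_mul_grToRational]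

theorem range_grToRational {α : Fin n → ℂ} {m : Fin n → ℕ} {b : Fin (n - 1) → ℕ}
    (hm : ∀ i, m i = latticeMult b i) :
    Set.range (grToRational (gradedSpan_le_range_opSum n (rootProd α m)) (weight b)) =
      globalSections (divisor b) := by
  have hrange (q : TorusRing) :
      q ∈ Set.range (grSymb (gradedSpan_le_range_opSum n (rootProd α m))) ↔
        ∀ e, q.coeff e ≠ 0 → ∀ j, -divisorCoeff b j ≤ pair (-((weight b : ℤ), 0) + e) j := by
    simp only [range_grSymb (monic_rootProd α m), natDegree_rootProd, hm, Set.mem_ofPred_eq,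
      forall_divisorCoeff_le_iff]
  have hshift (q : TorusRing) :
      (∀ e, (AddMonoidAlgebra.single (-((weight b : ℤ), 0)) 1 * q).coeff e ≠ 0 →
        ∀ j, -divisorCoeff b j ≤ pair e j) ↔
        q ∈ Set.range (grSymb (gradedSpan_le_range_opSum n (rootProd α m))) := by
    rw [hrange, ← (Equiv.addLeft (-((weight b : ℤ), (0 : ℤ)))).forall_congr_right]
    simp
  rw [globalSections_divisor]
  ext f
  constructor
  · rintro ⟨x, rfl⟩
    exact ⟨_, (hshift _).mpr ⟨x, rfl⟩, rfl⟩
  · rintro ⟨q, hq, rfl⟩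
    have hq' : AddMonoidAlgebra.single (-((weight b : ℤ), 0)) 1 *
        (AddMonoidAlgebra.single ((weight b : ℤ), 0) (1 : ℂ) * q) = q := by
      rw [← mul_assoc, AddMonoidAlgebra.single_mul_single, neg_add_cancel, mul_one,
        ← AddMonoidAlgebra.one_def, one_mul]
    obtain ⟨x, hx⟩ := (hshift (AddMonoidAlgebra.single ((weight b : ℤ), 0) 1 * q)).mp (by rwa [hq'])
    exact ⟨x, by rw [grToRational_apply, hx, hq']⟩

end Comparison

end Kleinian

theorem mainTheorem2 (n : ℕ) [NeZero n] (k r r' : Fin (n - 1) → ℂ) (hk : IsDominant k)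
    (c b : Fin (n - 1) → ℕ) (hr : r = k + latticeF c) (hr' : r' = r + latticeF b)
    (l : List (Fin (n - 1))) (hl : r + (l.map wVec).sum = r') :
    ∃ Ψ : Gr (bimodule r l) →ₗ[ℂ] (ToricSurface n).functionField,
      Function.Injective Ψ ∧
      Set.range Ψ = globalSections (divisor b) ∧
      ∀ (N : ℕ) (β : ↥(bimodule r l ⊓ orderLE n N)),
        ∃ (f : ℤ →₀ ℂ) (q : TorusRing),
          (β : CrossedProduct n) - idem n 0 * evalY n f * del n ^ N ∈ orderLT n N ∧
          toSymbol n q = symbol f N ∧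
          toRational n (AddMonoidAlgebra.single ((weight b : ℤ), 0) 1) *
            Ψ (grClass (bimodule r l) N β) = toRational n q := by
  have hlb : (l.map wVec).sum = latticeF b := add_left_cancel (hl.trans hr')
  subst hr
  rw [bimodule_eq_gradedSpan l _ (dominantParam_add_latticeF hk c)]
  have hB := gradedSpan_le_range_opSum n (rootProd (rootParam (k + latticeF c)) (listMult l))
  refine ⟨grToRational hB (weight b), grToRational_injective hB _,
    range_grToRational (listMult_eq_latticeMult hlb), fun N β =>
      ⟨leadingCoeff n N (opCoords hB N β), symb n N (opCoords hB N β), ?_, toSymbol_symb n N _, ?_⟩⟩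
  · have h := opSum_sub_mem_orderLT n (natDegree_opCoords_le hB N β)
    rwa [opSum_opCoords] at h
  · rw [single_mul_grToRational, grSymb_grClass]
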